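/- Computability is Type-2 computability with names in Baire space $\mathbb N^{\mathbb N}$. A computable metric space $(X,d,\nu)$ is a nonempty metric space with a dense sequence $\nu:\mathbb N\to X$ such that $d(\nu(i),\nu(j))$ is a computable double sequence of reals. Its ideal balls are the balls $\alpha(a)$ with centre in $\nu(\mathbb N)$ and positive rational radius, and $\delta_X$ is its Cauchy representation. Fix a prime $p$ and let $K=\mathbb Q_p$, with $|\cdot|=|\cdot|_p$ and with the Cauchy representation $\delta_K$ obtained from a standard numbering of $\mathbb Q$. Representations. $\Sigma^0_1(X)$: an open set is named by an enumeration (padding allowed) of ideal balls with that union. $\Pi^0_1(X)$: a closed set is named by a name of its complement. $\delta_{\mathrm{range}}$: a closed set is named by a list of names of a dense sequence in it (with a special name for $\emptyset$). $\delta^{>}_{\mathrm{dist}}$: a closed set $A$ is named by a name of a realizer of $x\mapsto d(x,A)$ into the extended reals, represented by enumerations of all rational strict lower bounds. $\mathcal K_{>}(X)$: a compact set is named by a list of exactly all codes of its finite covers by ideal balls. $[\delta_X\to\delta_K]_{\mathcal Z}$: a partial map $X\to K$ that has a continuous realizer and has domain in $\mathcal Z$ is named by (a name of) a continuous realizer together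 with a name of its domain in $\mathcal Z$; these maps form $C_{\mathcal Z}(X,K)$. For total maps $C(X,K)$ the representation $[\delta_X\to\delta_K]$ uses the realizer only. A Dugundji system for a nonempty closed set $A\subseteq X$ is a pair $((V_i)_{i\in\mathbb N},(y_i)_{i\in\mathbb N})$ of open sets $V_i$ and points $y_i\in A$ such that $\bigcup_iV_i=X\setminus A$; every point of $\bigcup_i V_i$ has a neighbourhood meeting only finitely many $V_j$; $d(x,y_i)\le 2\,d(x,A)$ for all $x\in V_i$; and whenever $d(V_{n_i},A)\to0$ for a sequence $(n_i)$ of indices, $\operatorname{diam}V_{n_i}\to0$. It is named by names of all $V_i$ and all $y_i$, a sequence $(B_k)_k$ of (codes of) ideal balls or empty sets with $\bigcup_kB_k=\bigcup_iV_i$, and for each $k$ a finite set of indices containing every $j$ with $V_j\cap B_k\ne\emptyset$; call this representation $\delta_3$, of the set $\mathcal D(X)$ of Dugundji systems. A $K$-valued partition of unity subordinate to $(V_i)_i$ is a sequence of $f_i\in C_{\Sigma^0_1(X)}(X,K)$ with domain $Y=\bigcup_jV_j$ such that $\{x\in Y: f_i(x)\neq0\}\subseteq V_i$ and $|f_i|\le1$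 on $Y$ for every $i$, and $\sum_if_i=1$ on $Y$. A set $C\subseteq K$ is ultrametrically convex if for all $x,y\in C$ the closed ball $\{z:|z-x|\le|x-y|\}$ is contained in $C$. Theorem. Let $X$ be a zero-dimensional computable metric space such that all closed balls $\overline B(x,2^{-N})=\{z:d(x,z)\le2^{-N}\}$ ($x\in X$, $N\in\mathbb N$) are compact and the map $X\times\mathbb N\to\mathcal K_{>}(X)$, $(x,N)\mapsto\overline B(x,2^{-N})$, is computable. Consider all tuples $(A;(V_i)_i,(y_i)_i;(f_i)_i;h)$ where 1. $A\subseteq X$ is closed, $\emptyset\ne A\ne X$, and $((V_i)_i,(y_i)_i)$ is a Dugundji system for $A$; 2. $(f_i)_i$ is a $K$-valued partition of unity subordinate to $(V_i)_i$; 3. $h\in C_{\Pi^0_1(X)}(X,K)$ has domain $A$ and is a homeomorphism from $A$ onto an ultrametrically convex set $h(A)\subseteq K$. For each such tuple and each $x\in X\setminus A$ the sum $\sum_ih(y_i)f_i(x)$ has only finitely many nonzero terms and lies in $h(A)$, so that $$r(x)=x\ \ (x\in A),\qquad r(x)=h^{-1}\Big(\sum_{i\in\mathbb N}h(y_i)f_i(x)\Big)\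 \ (x\in X\setminus A)$$ defines a map $r:X\to X$; $r$ and $h\circ r:X\to K$ are continuous. The operator $\theta$ defined on these tuples by $$\theta\big(A;(V_i)_i,(y_i)_i;(f_i)_i;h\big)=h\circ r\in C(X,K)$$ is $(\delta,[\delta_X\to\delta_K])$-computable, where $\delta=\big[\delta_{\mathrm{range}}\sqcap\delta^{>}_{\mathrm{dist}},\ \delta_3,\ [\delta_X\to\delta_K]_{\Sigma^0_1(X)}^{\omega},\ [\delta_X\to\delta_K]_{\Pi^0_1(X)}\big]$. -/

import Mathlib

open Set Filter Topology

/-! ### Type-two computability on Baire space -/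

/-- Baire space. -/
abbrev Baire : Type := ℕ → ℕ

namespace Baire

/-- The first `k` entries of `q`. -/
def take (q : Baire) (k : ℕ) : List ℕ := (List.range k).map q

/-- A number coding the query "entry `n` of the output, having read the first `k` entries of `q`". -/
def query (n : ℕ) (q : Baire) (k : ℕ) : ℕ := Encodable.encode ((n, take q k) : ℕ × List ℕ)

/-- The canonical representation `p ↦ eta p` of the continuous partial maps of Baire space
with `G_δ` domain. The point `p` is read as the table of a procedure that, to determine entry `n`
of the output on input `q`, inspects longer and longer prefixes of `q`; the value `0` means
"not yet decided" and the first value `m + 1` that occurs means that the entry is `m`.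
The input `q` is in the domain if every entry is decided at some stage.
The computable partial maps are the `eta p` with `p` a recursive function. -/
def eta (p : Baire) : Baire →. Baire := fun q =>
  ⟨∀ n, ∃ k, p (query n q k) ≠ 0, fun hq n => p (query n q (Nat.find (hq n))) - 1⟩

/-- First component of the interleaving pairing `⟨p, q⟩ = (p₀, q₀, p₁, q₁, …)`. -/
def fst (s : Baire) : Baire := fun n => s (2 * n)

/-- Second component of the interleaving pairing. -/
def snd (s : Baire) : Baire := fun n => s (2 * n + 1)

/-- Component `i` of the countable tupling `⟨p⁽⁰⁾, p⁽¹⁾, …⟩`. -/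
def comp (s : Baire) (i : ℕ) : Baire := fun k => s (Nat.pair i k)

end Baire

open Baire

/-- A representation, given by the relation "`p` is a name of `x`". -/
abbrev Naming (X : Type*) := Baire → X → Prop

/-- `F` is a `(δX, δY)`-realizer of the partial map `f`. -/
def Realizes {X Y : Type*} (δX : Naming X) (δY : Naming Y)
    (F : Baire →. Baire) (f : X →. Y) : Prop :=
  ∀ q x y, δX q x → y ∈ f x → ∃ r ∈ F q, δY r y

/-- `f` is `(δX, δY)`-computable. -/
def IsComputableMap {X Y : Type*} (δX : Naming X) (δY : Naming Y) (f : X →. Y) : Prop :=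
  ∃ c : Baire, Computable c ∧ Realizes δX δY (eta c) f

/-- `f` is `(δX, δY)`-continuous: it has a continuous realizer. -/
def IsRelContinuous {X Y : Type*} (δX : Naming X) (δY : Naming Y) (f : X →. Y) : Prop :=
  ∃ c : Baire, Realizes δX δY (eta c) f

/-- The representation `δ_ℕ`. -/
def natNaming : Naming ℕ := fun p n => p 0 = n

/-- The product representation `[δX, δY]`. -/
def prodNaming {X Y : Type*} (δX : Naming X) (δY : Naming Y) : Naming (X × Y) :=
  fun s z => δX (fst s) z.1 ∧ δY (snd s) z.2

/-- The countable power `δ^ω`. -/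
def seqNaming {X : Type*} (δ : Naming X) : Naming (ℕ → X) :=
  fun s x => ∀ i, δ (comp s i) (x i)

/-- The meet `δ ⊓ δ'` of two representations of the same set. -/
def meetNaming {X : Type*} (δ δ' : Naming X) : Naming X :=
  fun s x => δ (fst s) x ∧ δ' (snd s) x

/-- The representation `[δX → δY]` of total relatively continuous maps. -/
def funNaming {X Y : Type*} (δX : Naming X) (δY : Naming Y) : Naming (X → Y) :=
  fun s f => Realizes δX δY (eta s) (PFun.lift f)

/-- The representation `[δX → δY]_𝒵` of partial relatively continuous maps with domain in `𝒵`,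
where `δZ` represents `𝒵`. -/
def pfunNaming {X Y : Type*} (δX : Naming X) (δY : Naming Y) (δZ : Naming (Set X)) :
    Naming (X →. Y) :=
  fun s f => Realizes δX δY (eta (fst s)) f ∧ δZ (snd s) f.Dom

/-! ### Computable metric spaces and their hyperspaces -/

/-- The standard numbering `⟨⟨i, j⟩, k⟩ ↦ (i - j) / (k + 1)` of the rationals. -/
def ratNum (n : ℕ) : ℚ :=
  (((n.unpair.1.unpair.1 : ℚ) - (n.unpair.1.unpair.2 : ℚ))) / ((n.unpair.2 : ℚ) + 1)

/-- The standard numbering `⟨i, k⟩ ↦ (i + 1) / (k + 1)` of the positive rationals. -/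
def posRatNum (n : ℕ) : ℚ := ((n.unpair.1 : ℚ) + 1) / ((n.unpair.2 : ℚ) + 1)

/-- `(X, d, ν)` is a computable metric space: `ν` is dense and the double sequence
`d (ν i) (ν j)` of reals is computable. -/
structure IsComputableMetricSpace {X : Type*} [MetricSpace X] (ν : ℕ → X) : Prop where
  dense : DenseRange ν
  computable_dist : ∃ g : ℕ × ℕ × ℕ → ℕ, Computable g ∧
    ∀ i j k, |dist (ν i) (ν j) - (ratNum (g (i, j, k)) : ℝ)| ≤ (1 / 2 : ℝ) ^ k

/-- Dimension zero, for separable metrizable spaces: the clopen sets form a basis. -/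
def IsZeroDimensional (X : Type*) [TopologicalSpace X] : Prop :=
  TopologicalSpace.IsTopologicalBasis {s : Set X | IsClopen s}

section MetricSpaces

variable {X : Type*} [MetricSpace X]

/-- The Cauchy representation. -/
def cauchyNaming (ν : ℕ → X) : Naming X := fun p x =>
  (∀ i j, dist (ν (p i)) (ν (p j)) < (1 / 2 : ℝ) ^ (min i j)) ∧
    Tendsto (fun i => ν (p i)) atTop (𝓝 x)

/-- The numbering `α` of the ideal open balls. -/
def idealBall (ν : ℕ → X) (a : ℕ) : Set X :=
  Metric.ball (ν a.unpair.1) (posRatNum a.unpair.2 : ℝ)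

/-- The shifted numbering `α'`, with `α' 0 = ∅` and `α' (a + 1) = α a`. -/
def idealBall' (ν : ℕ → X) : ℕ → Set X
  | 0 => ∅
  | a + 1 => idealBall ν a

/-- The representation of the open sets `Σ⁰₁(X)`: `p` enumerates (with `0` as padding)
the codes, plus one, of ideal balls with union `U`. -/
def openNaming (ν : ℕ → X) : Naming (Set X) := fun p U => U = ⋃ i, idealBall' ν (p i)

/-- The representation of the closed sets `Π⁰₁(X)` by names of the complement. -/
def closedNaming (ν : ℕ → X) : Naming (Set X) := fun p A => openNaming ν p Aᶜ

/-- The representation `δ_range` of the closed sets: a name lists names (shifted by one)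
of a dense sequence in `A`, and is identically zero if `A` is empty. -/
def rangeNaming (ν : ℕ → X) : Naming (Set X) := fun s A =>
  IsClosed A ∧
    ((A = ∅ ∧ ∀ i k, comp s i k = 0) ∨
      (A.Nonempty ∧ ∃ z : ℕ → X,
        (∀ i, (∀ k, 1 ≤ comp s i k) ∧ cauchyNaming ν (fun k => comp s i k - 1) (z i) ∧ z i ∈ A) ∧
        A ⊆ closure (range z)))

/-- The representation of the extended reals by enumerations (with `0` as padding)
of all rational lower bounds. -/
def lowerNaming : Naming EReal := fun p t =>
  ∀ n, (((ratNum n : ℝ) : EReal) < t ↔ ∃ i, p i = n + 1)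

/-- The representation `δ_dist^>` of the closed sets: a name realizes the distance function
`d_A` as a lower semicontinuous function (with `d_∅ = ∞`). -/
def distNaming (ν : ℕ → X) : Naming (Set X) := fun p A =>
  IsClosed A ∧ funNaming (cauchyNaming ν) lowerNaming p
    (fun x => ((Metric.infEDist x A : ENNReal) : EReal))

/-- The representation of the compact sets (the space `𝒦_>(X)`): a name of `S` is a list,
without padding, of all codes of finite covers of `S` by ideal balls. -/
def compactNaming (ν : ℕ → X) : Naming (Set X) := fun p S =>
  IsCompact S ∧ ∀ n, (∃ i, p i = n) ↔
    ∃ w : List ℕ, Encodable.encode w = n ∧ S ⊆ ⋃ a ∈ w, idealBall ν a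

/-! ### Dugundji systems -/

/-- The class `LF` for open sets: each point of the union of the family has a basic neighbourhood
that meets only finitely many members. -/
def IsLocallyFiniteInUnion (ν : ℕ → X) (V : ℕ → Set X) : Prop :=
  (∀ i, IsOpen (V i)) ∧
    ∀ i, ∀ x ∈ V i, ∃ a, x ∈ idealBall' ν a ∧ {j | (V j ∩ idealBall' ν a).Nonempty}.Finite

/-- The representation `δ₂`: a name `⟨p, q, r⟩` of `V` consists of names `p` of the open sets
`V j`, a sequence `q` of codes of ideal balls with union `⋃ j, V j`, and for each `i` a
(binary) code `r i` of a finite set containing all `j` such that `V j` meets ball `q i`. -/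
def lfNaming (ν : ℕ → X) : Naming (ℕ → Set X) := fun s V =>
  IsLocallyFiniteInUnion ν V ∧
    seqNaming (openNaming ν) (fst s) V ∧
    (⋃ j, V j) = (⋃ i, idealBall' ν (fst (snd s) i)) ∧
    ∀ i j, (V j ∩ idealBall' ν (fst (snd s) i)).Nonempty → (snd (snd s) i).testBit j = true

/-- `(V, y)` is a Dugundji system for the nonempty closed set `A` with coefficient `1 + ε`.
Distances of sets and diameters are taken in `[0, ∞]`. -/
structure IsDugundjiSystem (ν : ℕ → X) (ε : ℝ) (A : Set X) (V : ℕ → Set X) (y : ℕ → X) :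
    Prop where
  isClosed : IsClosed A
  nonempty : A.Nonempty
  locallyFinite : IsLocallyFiniteInUnion ν V
  iUnion_eq : (⋃ i, V i) = Aᶜ
  mem : ∀ i, y i ∈ A
  dist_le : ∀ i, ∀ x ∈ V i, dist x (y i) ≤ (1 + ε) * Metric.infDist x A
  diam_tendsto : ∀ n : ℕ → ℕ,
    Tendsto (fun i => ⨅ x ∈ V (n i), Metric.infEDist x A) atTop (𝓝 0) →
    Tendsto (fun i => Metric.ediam (V (n i))) atTop (𝓝 0)

/-- The set `𝒟(X)` of Dugundji systems (with coefficient `2`). -/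
def DugundjiSystems (ν : ℕ → X) : Set ((ℕ → Set X) × (ℕ → X)) :=
  {D | IsDugundjiSystem ν 1 (⋃ i, D.1 i)ᶜ D.1 D.2}

/-- The representation `δ₃` of `𝒟(X)`. -/
def dugundjiNaming (ν : ℕ → X) : Naming ((ℕ → Set X) × (ℕ → X)) := fun s D =>
  D ∈ DugundjiSystems ν ∧ prodNaming (lfNaming ν) (seqNaming (cauchyNaming ν)) s D

/-! ### The operator `θ` -/

/-- A subset of an ultrametric space is ultrametrically convex if with `x, y` it contains the
smallest closed ball `[x, y]` containing them. -/
def UltrametricallyConvex (C : Set X) : Prop :=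
  ∀ x ∈ C, ∀ y ∈ C, Metric.closedBall x (dist x y) ⊆ C

open Classical in
/-- The value of a partial map into a field (`0` off the domain, where it is not used). -/
noncomputable def PFun.val {X K : Type*} [Zero K] (f : X →. K) (x : X) : K := (f x).getOrElse 0

variable (p : ℕ) [Fact p.Prime]

/-- The Cauchy representation of `ℚ_p`, from the standard numbering of `ℚ`. -/
def padicNaming : Naming ℚ_[p] := cauchyNaming (fun n => (ratNum n : ℚ_[p]))

variable {p}

/-- `f` is a partition of unity subordinate to the open sets `V` with values in `ℚ_p`. -/
structure IsPadicPartitionOfUnity (ν : ℕ → X) (V : ℕ → Set X) (f : ℕ → X →. ℚ_[p]) : Prop where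
  continuous : ∀ i, IsRelContinuous (cauchyNaming ν) (padicNaming p) (f i)
  dom_eq : ∀ i, (f i).Dom = ⋃ j, V j
  subordinate : ∀ i, ∀ x ∈ ⋃ j, V j, (f i).val x ≠ 0 → x ∈ V i
  norm_le_one : ∀ i, ∀ x ∈ ⋃ j, V j, ‖(f i).val x‖ ≤ 1
  sum_eq_one : ∀ x ∈ ⋃ j, V j, ∑ᶠ i, (f i).val x = 1

/-- `h` is a homeomorphism of `A` onto an ultrametrically convex subset of `ℚ_p`. -/
structure IsHomeoOntoConvex (ν : ℕ → X) (A : Set X) (h : X →. ℚ_[p]) : Prop where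
  continuous : IsRelContinuous (cauchyNaming ν) (padicNaming p) h
  dom_eq : h.Dom = A
  isEmbedding : IsEmbedding (fun a : A => h.val (a : X))
  convex : UltrametricallyConvex (h.val '' A)

open Classical in
/-- The retraction: the identity on `A`, and `x ↦ h⁻¹ (∑ i, h (y i) * f i x)` off `A`. -/
noncomputable def retract [Nonempty X] (A : Set X) (y : ℕ → X) (f : ℕ → X →. ℚ_[p])
    (h : X →. ℚ_[p]) (x : X) : X :=
  if x ∈ A then x else Function.invFunOn h.val A (∑ᶠ i, h.val (y i) * (f i).val x)

/-- The tuples `(A; (V, y); f; h)` on which `θ` is defined. -/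
structure ThetaDom (ν : ℕ → X) (A : Set X) (V : ℕ → Set X) (y : ℕ → X) (f : ℕ → X →. ℚ_[p])
    (h : X →. ℚ_[p]) : Prop where
  nonempty : A.Nonempty
  ne_univ : A ≠ univ
  mem_systems : (V, y) ∈ DugundjiSystems ν
  compl_eq : (⋃ i, V i)ᶜ = A
  partition : IsPadicPartitionOfUnity ν V f
  homeo : IsHomeoOntoConvex ν A h

/-- The partial operator `θ (A; (V, y); f; h) = h ∘ r`. -/
noncomputable def theta [Nonempty X] (ν : ℕ → X) :
    Set X × ((ℕ → Set X) × (ℕ → X)) × (ℕ → X →. ℚ_[p]) × (X →. ℚ_[p]) →. (X → ℚ_[p]) :=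
  fun t => ⟨ThetaDom ν t.1 t.2.1.1 t.2.1.2 t.2.2.1 t.2.2.2,
    fun _ x => t.2.2.2.val (retract t.1 t.2.1.2 t.2.2.1 t.2.2.2 x)⟩

variable (p) in
/-- The representation
`[δ_range ⊓ δ_dist^>, δ₃, [δ_X → δ_K]_{Σ⁰₁(X)}^ω, [δ_X → δ_K]_{Π⁰₁(X)}]`. -/
def thetaInputNaming (ν : ℕ → X) :
    Naming (Set X × ((ℕ → Set X) × (ℕ → X)) × (ℕ → X →. ℚ_[p]) × (X →. ℚ_[p])) :=
  prodNaming (meetNaming (rangeNaming ν) (distNaming ν))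
    (prodNaming (dugundjiNaming ν)
      (prodNaming (seqNaming (pfunNaming (cauchyNaming ν) (padicNaming p) (openNaming ν)))
        (pfunNaming (cauchyNaming ν) (padicNaming p) (closedNaming ν))))

end MetricSpaces

/-! ### Prefixes and decisions of tables -/

namespace Baire

/-! Everything rests on one ultrametric estimate. Off `A`, the value `h (r x)` is a combination of
values `h (y i)` with coefficients of norm at most one and sum one. If all `h (y i)` with `f i x ≠
0` lie within `ρ` of some `d`, then so does the combination (`norm_finsum_sub_le`). Since those `y
i` are at distance at most `2 d(x, A)` from `x`, the value `h (r x)` is within `ρ` of `d` as soon as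
`h a` is for every `a ∈ A` with `d(x, a) ≤ 2 d(x, A)`; this holds for `x ∈ A` too
(`norm_val_retract_sub_le`). Convexity of `h(A)` puts the sum into `h(A)`, and the estimate gives
continuity at points of `A`.

For computability, two kinds of certificate show that a rational `d` approximates `h (r x)`. Far
from `A`, a ball of the Dugundji system containing `x` bounds the relevant indices; the finite sum
is evaluated termwise, and errors do not add up in an ultrametric field (`FarApprox.norm_le`). Near
`A`, the realizer of `h` is run on the name of `x`, although `x` need not lie in `A`. If it answers
after `k` entries and some point of `A` is close enough to `x`, then every almost closest point of
`A` has a name with the same `k` entries, so the answer is right for all of them and hence for `h (r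
x)` (`NearApprox.norm_le`).

Both kinds are sound for every `x`. Near certificates exist on `A` and far ones off `A`, so a search
that never decides whether `x ∈ A` terminates. Certificates are semidecidable in the two oracles,
the name `s` of the tuple and the name `q` of `x`, and `IsSemidecidable.exists_realizer` turns such
a relation into a computable map from `s` to a realizer. -/

@[simp] theorem length_take (q : Baire) (k : ℕ) : (take q k).length = k := by simp [take]

theorem getElem?_take (q : Baire) (k i : ℕ) :
    (take q k)[i]? = if i < k then some (q i) else none := by
  simp [take]
  split_ifs <;> simp_all

theorem take_eq_take_iff {q q' : Baire} {k : ℕ} :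
    take q k = take q' k ↔ ∀ i < k, q i = q' i := by
  simp [take]

theorem take_take_of_le (q : Baire) {j k : ℕ} (h : j ≤ k) : (take q k).take j = take q j := by
  simp [take, ← List.map_take, List.take_range, h]

theorem query_congr {q q' : Baire} {k : ℕ} (n : ℕ) (h : ∀ i < k, q i = q' i) :
    query n q k = query n q' k := by
  simp only [query, take_eq_take_iff.2 h]

/-- The table `p` decides entry `n` of the output on input `q` at stage `k`, with value `m`. -/
def Decides (p q : Baire) (n k m : ℕ) : Prop :=
  p (query n q k) = m + 1 ∧ ∀ j < k, p (query n q j) = 0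

/-- Use principle: a decision at stage `k` inspects only the first `k` entries of the oracle. -/
theorem Decides.congr {p q q' : Baire} {n k m : ℕ} (hd : Decides p q n k m)
    (h : ∀ i < k, q i = q' i) : Decides p q' n k m := by
  refine ⟨?_, fun j hj => ?_⟩
  · rw [← query_congr n h]; exact hd.1
  · rw [← query_congr n fun i hi => h i (hi.trans hj)]; exact hd.2 j hj

theorem exists_decides_of_mem_eta {p q r : Baire} (h : r ∈ eta p q) (n : ℕ) :
    ∃ k, Decides p q n k (r n) := by
  obtain ⟨hq, rfl⟩ := h
  refine ⟨Nat.find (hq n), ?_, fun j hj => not_not.1 (Nat.find_min (hq n) hj)⟩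
  have := Nat.find_spec (hq n)
  simp only [eta]
  omega

theorem eq_of_mem_eta_of_decides {p q r : Baire} (h : r ∈ eta p q) {n k m : ℕ}
    (hd : Decides p q n k m) : r n = m := by
  obtain ⟨hq, rfl⟩ := h
  have : Nat.find (hq n) = k := by
    rw [Nat.find_eq_iff]
    exact ⟨by rw [hd.1]; omega, fun j hj => not_not.2 (hd.2 j hj)⟩
  simp only [eta, this, hd.1, Nat.add_sub_cancel]

theorem exists_mem_eta_of_decides {p q r : Baire} (h : ∀ n, ∃ k, Decides p q n k (r n)) :
    r ∈ eta p q := by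
  have hq : ∀ n, ∃ k, p (query n q k) ≠ 0 := fun n => by
    obtain ⟨k, hk⟩ := h n
    exact ⟨k, by rw [hk.1]; omega⟩
  have hmem : (eta p q).get hq ∈ eta p q := Part.get_mem _
  have : (eta p q).get hq = r := by
    funext n
    obtain ⟨k, hk⟩ := h n
    exact eq_of_mem_eta_of_decides hmem hk
  exact this ▸ hmem

end Baire

/-! ### Semidecidable relations with two oracles -/

/-- A relation on `α × Baire × Baire` is semidecidable if its instances are those confirmed by a
number `w` and by all sufficiently long prefixes of the two oracles. -/
def IsSemidecidable {α : Type*} [Primcodable α] (R : α → Baire → Baire → Prop) : Prop :=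
  ∃ chk : (α × ℕ) × List ℕ × List ℕ → Bool, Computable chk ∧ ∀ a s q,
    (∀ w k, chk ((a, w), take s k, take q k) = true → R a s q) ∧
    (R a s q → ∃ w K, ∀ k ≥ K, chk ((a, w), take s k, take q k) = true)

theorem Computable.forall_lt {α : Type*} [Primcodable α] {f : α × ℕ → Bool} (hf : Computable f)
    {n : α → ℕ} (hn : Computable n) :
    ∃ g : α → Bool, Computable g ∧ ∀ a, g a = true ↔ ∀ i < n a, f (a, i) = true := by
  refine ⟨fun a => Nat.rec true (fun i b => b && f (a, i)) (n a),
    Computable.nat_rec hn (Computable.const true)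
      (Primrec.and.to_comp.comp (Computable.snd.comp Computable.snd)
        (hf.comp (Computable.fst.pair (Computable.fst.comp Computable.snd)))).to₂, fun a => ?_⟩
  beta_reduce
  generalize n a = m
  induction m with
  | zero => simp
  | succ m ih => rw [Nat.forall_lt_succ_right, ← ih, Bool.and_eq_true]

/-- Bounded search with a computable test. -/
theorem Computable.exists_search {α : Type*} [Primcodable α] {f : α × ℕ → Bool}
    (hf : Computable f) : ∃ g : α × ℕ → ℕ, Computable g ∧ ∀ a n,
      (∀ w, g (a, n) = w + 1 → f (a, w) = true) ∧
      ∀ w < n, f (a, w) = true → g (a, n) ≠ 0 := by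
  refine ⟨fun x => Nat.rec 0 (fun w r => bif f (x.1, w) then w + 1 else r) x.2,
    Computable.nat_rec Computable.snd (Computable.const 0) (Computable.cond
      (hf.comp ((Computable.fst.comp Computable.fst).pair (Computable.fst.comp Computable.snd)))
      (Computable.succ.comp (Computable.fst.comp Computable.snd))
      (Computable.snd.comp Computable.snd)).to₂, fun a n => ?_⟩
  beta_reduce
  induction n with
  | zero => simp
  | succ n ih =>
    dsimp only
    cases hn : f (a, n)
    · refine ⟨ih.1, fun w hw hfw => ih.2 w (lt_of_le_of_ne (Nat.lt_succ_iff.1 hw) ?_) hfw⟩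
      rintro rfl
      simp [hn] at hfw
    · simp [hn]

namespace IsSemidecidable

variable {α β : Type*} [Primcodable α] [Primcodable β]

theorem of_iff {R R' : α → Baire → Baire → Prop} (h : IsSemidecidable R)
    (he : ∀ a s q, R' a s q ↔ R a s q) : IsSemidecidable R' := by
  have : R' = R := by
    funext a s q
    exact propext (he a s q)
  exact this ▸ h

theorem of_computable {p : α → Bool} (hp : Computable p) :
    IsSemidecidable fun a _ _ => p a = true :=
  ⟨fun x => p x.1.1, hp.comp (Computable.fst.comp Computable.fst), fun _ _ _ =>
    ⟨fun _ _ h => h, fun h => ⟨0, 0, fun _ _ => h⟩⟩⟩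

theorem of_primrecPred {p : α → Prop} (hp : PrimrecPred p) : IsSemidecidable fun a _ _ => p a := by
  obtain ⟨_, hd⟩ := hp
  exact (of_computable hd.to_comp).of_iff fun a _ _ => by simp

theorem comp {R : β → Baire → Baire → Prop} (hR : IsSemidecidable R) {f : α → β}
    (hf : Computable f) : IsSemidecidable fun a => R (f a) := by
  obtain ⟨chk, hc, h⟩ := hR
  exact ⟨fun x => chk ((f x.1.1, x.1.2), x.2),
    hc.comp (((hf.comp (Computable.fst.comp Computable.fst)).pair
      (Computable.snd.comp Computable.fst)).pair Computable.snd), fun a => h (f a)⟩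

theorem and {R S : α → Baire → Baire → Prop} (hR : IsSemidecidable R) (hS : IsSemidecidable S) :
    IsSemidecidable fun a s q => R a s q ∧ S a s q := by
  obtain ⟨f, hf, hR⟩ := hR
  obtain ⟨g, hg, hS⟩ := hS
  have hw : Computable fun x : (α × ℕ) × List ℕ × List ℕ => x.1.2.unpair :=
    Computable.unpair.comp (Computable.snd.comp Computable.fst)
  refine ⟨fun x => f ((x.1.1, x.1.2.unpair.1), x.2) && g ((x.1.1, x.1.2.unpair.2), x.2),
    Primrec.and.to_comp.comp
      (hf.comp (((Computable.fst.comp Computable.fst).pair (Computable.fst.comp hw)).pair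
        Computable.snd))
      (hg.comp (((Computable.fst.comp Computable.fst).pair (Computable.snd.comp hw)).pair
        Computable.snd)), fun a s q => ⟨fun w k h => ?_, fun h => ?_⟩⟩
  · rw [Bool.and_eq_true] at h
    exact ⟨(hR a s q).1 _ _ h.1, (hS a s q).1 _ _ h.2⟩
  · obtain ⟨w, K, hw⟩ := (hR a s q).2 h.1
    obtain ⟨w', K', hw'⟩ := (hS a s q).2 h.2
    -- Confirmations persist on all longer prefixes, so both tests succeed together from the larger
    -- threshold on.
    refine ⟨Nat.pair w w', max K K', fun k hk => ?_⟩
    simp [hw k (le_of_max_le_left hk), hw' k (le_of_max_le_right hk)]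

theorem or {R S : α → Baire → Baire → Prop} (hR : IsSemidecidable R) (hS : IsSemidecidable S) :
    IsSemidecidable fun a s q => R a s q ∨ S a s q := by
  obtain ⟨f, hf, hR⟩ := hR
  obtain ⟨g, hg, hS⟩ := hS
  refine ⟨fun x => f x || g x, Primrec.or.to_comp.comp hf hg,
    fun a s q => ⟨fun w k h => ?_, fun h => ?_⟩⟩
  · rw [Bool.or_eq_true] at h
    exact h.imp ((hR a s q).1 _ _) ((hS a s q).1 _ _)
  · rcases h with h | h
    · obtain ⟨w, K, hw⟩ := (hR a s q).2 h
      exact ⟨w, K, fun k hk => by simp [hw k hk]⟩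
    · obtain ⟨w, K, hw⟩ := (hS a s q).2 h
      exact ⟨w, K, fun k hk => by simp [hw k hk]⟩

theorem exists_nat {R : α × ℕ → Baire → Baire → Prop} (hR : IsSemidecidable R) :
    IsSemidecidable fun a s q => ∃ b, R (a, b) s q := by
  obtain ⟨f, hf, hR⟩ := hR
  have hw : Computable fun x : (α × ℕ) × List ℕ × List ℕ => x.1.2.unpair :=
    Computable.unpair.comp (Computable.snd.comp Computable.fst)
  refine ⟨fun x => f (((x.1.1, x.1.2.unpair.1), x.1.2.unpair.2), x.2),
    hf.comp ((((Computable.fst.comp Computable.fst).pair (Computable.fst.comp hw)).pair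
      (Computable.snd.comp hw)).pair Computable.snd),
    fun a s q => ⟨fun w k h => ⟨_, (hR _ s q).1 _ _ h⟩, ?_⟩⟩
  rintro ⟨b, h⟩
  obtain ⟨w, K, hw⟩ := (hR _ s q).2 h
  exact ⟨Nat.pair b w, K, fun k hk => by simp [hw k hk]⟩

theorem exists_denumerable {γ : Type*} [Denumerable γ] {R : α × γ → Baire → Baire → Prop}
    (hR : IsSemidecidable R) : IsSemidecidable fun a s q => ∃ b, R (a, b) s q := by
  refine (exists_nat (R := fun x : α × ℕ => R (x.1, Denumerable.ofNat γ x.2))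
    (hR.comp (Computable.fst.pair ((Computable.ofNat γ).comp Computable.snd)))).of_iff
    fun a s q => ⟨?_, ?_⟩
  · rintro ⟨b, h⟩
    exact ⟨Encodable.encode b, by simpa using h⟩
  · rintro ⟨b, h⟩
    exact ⟨_, h⟩

/-- Finitely many witnesses are coded as one list, and the maximum of the finitely many thresholds
serves for all indices. -/
theorem forall_lt {R : α × ℕ → Baire → Baire → Prop} (hR : IsSemidecidable R) {n : α → ℕ}
    (hn : Computable n) : IsSemidecidable fun a s q => ∀ i < n a, R (a, i) s q := by
  obtain ⟨f, hf, hR⟩ := hR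
  have h1 : Computable fun x : ((α × ℕ) × List ℕ × List ℕ) × ℕ =>
      f (((x.1.1.1, x.2), (Denumerable.ofNat (List ℕ) x.1.1.2).getD x.2 0), x.1.2) := by
    refine hf.comp (Computable.pair (Computable.pair (Computable.pair ?_ ?_) ?_) ?_)
    · exact Computable.fst.comp (Computable.fst.comp Computable.fst)
    · exact Computable.snd
    · exact (Primrec.list_getD 0).to_comp.comp ((Computable.ofNat (List ℕ)).comp
        (Computable.snd.comp (Computable.fst.comp Computable.fst))) Computable.snd
    · exact Computable.snd.comp Computable.fst
  obtain ⟨g, hg, hgf⟩ := Computable.forall_lt h1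
    (n := fun x : (α × ℕ) × List ℕ × List ℕ => n x.1.1)
    (hn.comp (Computable.fst.comp Computable.fst))
  refine ⟨g, hg, fun a s q => ⟨fun w k h i hi => ?_, fun h => ?_⟩⟩
  · exact (hR _ s q).1 _ _ ((hgf _).1 h i hi)
  · have : ∀ i, ∃ w K, i < n a → ∀ k ≥ K, f (((a, i), w), take s k, take q k) = true := fun i => by
      by_cases hi : i < n a
      · obtain ⟨w, K, hw⟩ := (hR _ s q).2 (h i hi)
        exact ⟨w, K, fun _ => hw⟩
      · exact ⟨0, 0, fun h => absurd h hi⟩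
    choose w K hw using this
    refine ⟨Encodable.encode ((List.range (n a)).map w), (Finset.range (n a)).sup K,
      fun k hk => (hgf _).2 fun i hi => ?_⟩
    have hK : K i ≤ k := (Finset.le_sup (Finset.mem_range.2 hi)).trans hk
    have := hw i hi k hK
    simpa [List.getD, List.getElem?_range, hi] using this

/-- Looking up an entry beyond the prefix yields `none`, so a short prefix never confirms anything
wrongly. -/
theorem left {e v : α → ℕ} (he : Computable e) (hv : Computable v) :
    IsSemidecidable fun a s _ => s (e a) = v a := by
  have h1 : Computable₂ fun o o' : Option ℕ => decide (o = o') := Primrec.eq.decide.to_comp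
  refine ⟨fun x => decide (x.2.1[e x.1.1]? = some (v x.1.1)), ?_, fun a s q => ⟨fun w k h => ?_, fun h => ?_⟩⟩
  · exact h1.comp (Computable.list_getElem?.comp (Computable.fst.comp Computable.snd)
      (he.comp (Computable.fst.comp Computable.fst)))
      (Computable.option_some.comp (hv.comp (Computable.fst.comp Computable.fst)))
  · simp only [getElem?_take, decide_eq_true_eq] at h
    split_ifs at h
    exact Option.some.inj h
  · refine ⟨0, e a + 1, fun k hk => ?_⟩
    simpa only [getElem?_take, if_pos (Nat.lt_of_succ_le hk), decide_eq_true_eq] using congrArg some h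

theorem right {e v : α → ℕ} (he : Computable e) (hv : Computable v) :
    IsSemidecidable fun a _ q => q (e a) = v a := by
  have h1 : Computable₂ fun o o' : Option ℕ => decide (o = o') := Primrec.eq.decide.to_comp
  refine ⟨fun x => decide (x.2.2[e x.1.1]? = some (v x.1.1)), ?_, fun a s q => ⟨fun w k h => ?_, fun h => ?_⟩⟩
  · exact h1.comp (Computable.list_getElem?.comp (Computable.snd.comp Computable.snd)
      (he.comp (Computable.fst.comp Computable.fst)))
      (Computable.option_some.comp (hv.comp (Computable.fst.comp Computable.fst)))
  · simp only [getElem?_take, decide_eq_true_eq] at h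
    split_ifs at h
    exact Option.some.inj h
  · refine ⟨0, e a + 1, fun k hk => ?_⟩
    simpa only [getElem?_take, if_pos (Nat.lt_of_succ_le hk), decide_eq_true_eq] using congrArg some h

end IsSemidecidable

/-- A functional with values in Baire space, with parameters in `α` and two oracles, is oracle
computable if the graph of its evaluation is semidecidable. -/
def IsOracleComputable {α : Type*} [Primcodable α] (F : α → Baire → Baire → Baire) : Prop :=
  IsSemidecidable fun (x : (α × ℕ) × ℕ) s q => F x.1.1 s q x.1.2 = x.2

/-! ### Evaluation of functionals with two oracles -/

namespace IsOracleComputable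

variable {α β : Type*} [Primcodable α] [Primcodable β]

theorem eval_eq {F : α → Baire → Baire → Baire} (hF : IsOracleComputable F) {e v : α → ℕ}
    (he : Computable e) (hv : Computable v) : IsSemidecidable fun a s q => F a s q (e a) = v a :=
  IsSemidecidable.comp hF (f := fun a => ((a, e a), v a)) ((Computable.id.pair he).pair hv)

theorem left : IsOracleComputable fun (_ : α) s _ => s :=
  IsSemidecidable.left (Computable.snd.comp Computable.fst) Computable.snd

theorem right : IsOracleComputable fun (_ : α) _ q => q :=
  IsSemidecidable.right (Computable.snd.comp Computable.fst) Computable.snd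

theorem reindex {F : α → Baire → Baire → Baire} (hF : IsOracleComputable F) {e : α → ℕ → ℕ}
    (he : Computable₂ e) : IsOracleComputable fun a s q n => F a s q (e a n) :=
  IsSemidecidable.comp hF (f := fun x : (α × ℕ) × ℕ => ((x.1.1, e x.1.1 x.1.2), x.2))
    (((Computable.fst.comp Computable.fst).pair
      (he.comp (Computable.fst.comp Computable.fst) (Computable.snd.comp Computable.fst))).pair
      Computable.snd)

theorem fst {F : α → Baire → Baire → Baire} (hF : IsOracleComputable F) :
    IsOracleComputable fun a s q => Baire.fst (F a s q) :=
  hF.reindex ((Primrec.nat_mul.comp (Primrec.const 2) Primrec.snd).to_comp.to₂)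

theorem snd {F : α → Baire → Baire → Baire} (hF : IsOracleComputable F) :
    IsOracleComputable fun a s q => Baire.snd (F a s q) :=
  hF.reindex ((Primrec.succ.comp (Primrec.nat_mul.comp (Primrec.const 2) Primrec.snd)).to_comp.to₂)

theorem comp {F : α → Baire → Baire → Baire} (hF : IsOracleComputable F) {i : α → ℕ}
    (hi : Computable i) : IsOracleComputable fun a s q => Baire.comp (F a s q) (i a) :=
  hF.reindex ((Primrec₂.natPair.to_comp.comp (hi.comp Computable.fst) Computable.snd).to₂)

/-- The stage at which a table with semidecidable entries decides an output. -/
theorem decides {P Q : α → Baire → Baire → Baire}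
    (hP : IsOracleComputable P) (hQ : IsOracleComputable Q)
    {n k m : α → ℕ} (hn : Computable n) (hk : Computable k) (hm : Computable m) :
    IsSemidecidable fun a s q => Decides (P a s q) (Q a s q) (n a) (k a) (m a) := by
  -- The functional `Q` is accessible only through confirmed values. Its prefix is therefore guessed
  -- as a list, whose length and entries are verified separately.
  have hlist : IsSemidecidable fun (x : α × List ℕ) s q =>
      ∀ i < k x.1, Q x.1 s q i = x.2.getD i 0 := by
    refine IsSemidecidable.forall_lt (R := fun y : (α × List ℕ) × ℕ => fun s q =>
      Q y.1.1 s q y.2 = y.1.2.getD y.2 0) (IsSemidecidable.comp hQ (f := fun y : (α × List ℕ) × ℕ =>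
      ((y.1.1, y.2), y.1.2.getD y.2 0)) ?_) (hk.comp Computable.fst)
    exact ((Computable.fst.comp Computable.fst).pair Computable.snd).pair
      ((Primrec.list_getD 0).to_comp.comp (Computable.snd.comp Computable.fst) Computable.snd)
  have hlen : IsSemidecidable fun (x : α × List ℕ) _ _ => x.2.length = k x.1 := by
    refine (IsSemidecidable.of_computable (p := fun x : α × List ℕ => x.2.length == k x.1) ?_).of_iff
      fun _ _ _ => by simp
    exact Primrec.beq.to_comp.comp (Computable.list_length.comp Computable.snd)
      (hk.comp Computable.fst)
  have hlast : IsSemidecidable fun (x : α × List ℕ) s q =>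
      P x.1 s q (Encodable.encode (n x.1, x.2)) = m x.1 + 1 :=
    IsSemidecidable.comp hP (f := fun x : α × List ℕ => ((x.1, Encodable.encode (n x.1, x.2)), m x.1 + 1))
      ((Computable.fst.pair (Computable.encode.comp ((hn.comp Computable.fst).pair
        Computable.snd))).pair (Computable.succ.comp (hm.comp Computable.fst)))
  have hbefore : IsSemidecidable fun (x : α × List ℕ) s q =>
      ∀ j < k x.1, P x.1 s q (Encodable.encode (n x.1, x.2.take j)) = 0 := by
    refine IsSemidecidable.forall_lt (R := fun y : (α × List ℕ) × ℕ => fun s q =>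
      P y.1.1 s q (Encodable.encode (n y.1.1, y.1.2.take y.2)) = 0)
      (IsSemidecidable.comp hP (f := fun y : (α × List ℕ) × ℕ =>
      ((y.1.1, Encodable.encode (n y.1.1, y.1.2.take y.2)), 0)) ?_) (hk.comp Computable.fst)
    exact ((Computable.fst.comp Computable.fst).pair (Computable.encode.comp
      ((hn.comp (Computable.fst.comp Computable.fst)).pair
      (Primrec.list_take.to_comp.comp Computable.snd (Computable.snd.comp Computable.fst))))).pair
      (Computable.const 0)
  refine (IsSemidecidable.exists_denumerable ((hlen.and hlist).and (hlast.and hbefore))).of_iff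
    fun a s q => ⟨fun h => ⟨take (Q a s q) (k a), ⟨by simp, fun i hi => ?_⟩, h.1,
      fun j hj => ?_⟩, ?_⟩
  · simp only at hi
    rw [List.getD_eq_getElem?_getD, getElem?_take, if_pos hi, Option.getD_some]
  · simpa only [take_take_of_le _ hj.le, query] using h.2 j hj
  · rintro ⟨l, ⟨hl, hl'⟩, h1, h2⟩
    have hl : l = take (Q a s q) (k a) := by
      refine List.ext_getElem? fun i => ?_
      rw [getElem?_take]
      split_ifs with hi
      · rw [hl' i hi, List.getD, List.getElem?_eq_getElem (by simpa [hl] using hi)]; simp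
      · simpa [hl] using hi
    subst hl
    refine ⟨h1, fun j hj => ?_⟩
    simpa only [take_take_of_le _ hj.le, query] using h2 j hj

end IsOracleComputable

/-- Uniformization: a semidecidable relation has computable realizers of its sections. -/
theorem IsSemidecidable.exists_realizer {R : ℕ × ℕ → Baire → Baire → Prop}
    (hR : IsSemidecidable R) : ∃ c : Baire, Computable c ∧ ∀ s, ∃ c' ∈ eta c s, ∀ q,
      (∀ n, ∃ d, R (n, d) s q) → ∃ r ∈ eta c' q, ∀ n, R (n, r n) s q := by
  obtain ⟨chk, hchk, h⟩ := hR
  -- A search candidate codes a value `d` together with a witness confirming it.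
  let test : (ℕ × List ℕ × List ℕ) × ℕ → Bool := fun x =>
    chk (((x.1.1, x.2.unpair.1), x.2.unpair.2), x.1.2)
  have htest : Computable test := by
    have hw : Computable fun x : (ℕ × List ℕ × List ℕ) × ℕ => x.2.unpair :=
      Computable.unpair.comp Computable.snd
    exact hchk.comp ((((Computable.fst.comp Computable.fst).pair (Computable.fst.comp hw)).pair
      (Computable.snd.comp hw)).pair (Computable.snd.comp Computable.fst))
  obtain ⟨search, hsearch, hspec⟩ := Computable.exists_search htest
  -- The search runs over candidates below the length of the prefix of `q`; the result is `d + 1` on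
  -- success and `0` for undecided, as `eta` expects.
  obtain ⟨g, hg, g_sound, g_complete⟩ : ∃ g : ℕ × List ℕ × List ℕ → ℕ, Computable g ∧
      (∀ x d, g x = d + 1 → ∃ w, test (x, w) = true ∧ w.unpair.1 = d) ∧
      ∀ x w, w < x.2.2.length → test (x, w) = true → g x ≠ 0 := by
    have hs : Computable fun x : ℕ × List ℕ × List ℕ => search (x, x.2.2.length) :=
      hsearch.comp (Computable.id.pair
        (Computable.list_length.comp (Computable.snd.comp Computable.snd)))
    refine ⟨fun x => bif search (x, x.2.2.length) = 0 then 0 else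
        (search (x, x.2.2.length) - 1).unpair.1 + 1,
      Computable.cond (Primrec.eq.decide.to_comp.comp hs (Computable.const 0)) (Computable.const 0)
        (Computable.succ.comp (Computable.fst.comp (Computable.unpair.comp
          (Computable.pred.comp hs)))),
      fun x d hx => ?_, fun x w hw hx => ?_⟩
    · cases hc : search (x, x.2.2.length) with
      | zero => simp [hc] at hx
      | succ w => exact ⟨w, (hspec _ _).1 w hc, by simpa [hc] using hx⟩
    · cases hc : search (x, x.2.2.length) with
      | zero => exact absurd hc ((hspec _ _).2 w hw hx)
      | succ w => simp [hc]
  let dec : ℕ → ℕ × List ℕ := Denumerable.ofNat (ℕ × List ℕ)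
  have hdec : Computable dec := Computable.ofNat _
  -- The entry of the output table at the code of `(n, prefix of q)` is computed from `s`. The table
  -- `c` waits until the prefix of `s` is as long as that of `q`, so that `g` sees prefixes of equal
  -- length; the outer successor marks the entry as decided even if `g` returns `0`.
  let c : Baire := fun m =>
    cond ((dec (dec m).1).2.length ≤ (dec m).2.length)
      (g ((dec (dec m).1).1, (dec m).2, (dec (dec m).1).2) + 1) 0
  have hc : Computable c := by
    have h1 : Computable fun m => dec (dec m).1 := hdec.comp (Computable.fst.comp hdec)
    refine Computable.cond ?_ (Computable.succ.comp (hg.comp ?_)) (Computable.const 0)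
    · exact (Primrec.nat_le.decide.to_comp.comp
        (Computable.list_length.comp (Computable.snd.comp h1))
        (Computable.list_length.comp (Computable.snd.comp hdec)))
    · exact (Computable.fst.comp h1).pair ((Computable.snd.comp hdec).pair (Computable.snd.comp h1))
  have hcq : ∀ m s k, c (query m s k) = cond ((dec m).2.length ≤ k)
      (g ((dec m).1, take s k, (dec m).2) + 1) 0 := by
    intro m s k
    have : dec (query m s k) = (m, take s k) := Denumerable.ofNat_encode _
    simp [c, this]
  refine ⟨c, hc, fun s => ⟨fun m => g ((dec m).1, take s (dec m).2.length, (dec m).2), ?_, ?_⟩⟩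
  · refine exists_mem_eta_of_decides fun m => ⟨(dec m).2.length, ?_, fun j hj => ?_⟩
    · simp [hcq]
    · simp [hcq, Nat.not_le.2 hj]
  · intro q hq
    have hval : ∀ n k, (fun m => g ((dec m).1, take s (dec m).2.length, (dec m).2)) (query n q k) =
        g (n, take s k, take q k) := by
      intro n k
      have : dec (query n q k) = (n, take q k) := Denumerable.ofNat_encode _
      simp [this]
    have hex : ∀ n, ∃ k, g (n, take s k, take q k) ≠ 0 := by
      intro n
      obtain ⟨d, hd⟩ := hq n
      obtain ⟨w, K, hw⟩ := (h _ s q).2 hd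
      -- The stage must exceed the threshold `K` and also be long enough for the bounded search to
      -- reach the candidate.
      refine ⟨max K (Nat.pair d w + 1), g_complete _ (Nat.pair d w) ?_ ?_⟩
      · simp
      · simpa [test] using hw _ (le_max_left _ _)
    have hmin := fun n => Nat.find_spec (hex n)
    refine ⟨fun n => g (n, take s (Nat.find (hex n)), take q (Nat.find (hex n))) - 1,
      exists_mem_eta_of_decides fun n => ⟨Nat.find (hex n), ?_, fun j hj => ?_⟩, fun n => ?_⟩
    · rw [hval]
      have := hmin n
      omega
    · rw [hval]
      exact not_not.1 (Nat.find_min (hex n) hj)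
    · obtain ⟨w, hw, hwd⟩ := g_sound (n, take s (Nat.find (hex n)), take q (Nat.find (hex n)))
        (g (n, take s (Nat.find (hex n)), take q (Nat.find (hex n))) - 1)
        (by have := hmin n; omega)
      beta_reduce
      rw [← hwd]
      exact (h _ s q).1 _ _ hw

theorem PFun.val_mem {X Y : Type*} [Zero Y] {f : X →. Y} {x : X} (hx : x ∈ f.Dom) :
    f.val x ∈ f x := by
  classical
  rw [PFun.val, Part.getOrElse_of_dom _ hx]
  exact Part.get_mem _

/-! ### Cauchy names -/

section CauchyNames

variable {X Y : Type*} [MetricSpace X] [MetricSpace Y] {ν : ℕ → X} {μ : ℕ → Y}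

theorem cauchyNaming.dist_le {q : Baire} {x : X} (h : cauchyNaming ν q x) (i : ℕ) :
    dist (ν (q i)) x ≤ (1 / 2 : ℝ) ^ i := by
  refine le_of_tendsto (tendsto_const_nhds.dist h.2) ?_
  filter_upwards [eventually_ge_atTop i] with j hj
  simpa [hj] using (h.1 i j).le

/-- The spare factor `1 / 2` makes two errors add up to less than the bound required between
entries. -/
theorem cauchyNaming.of_dist_lt {q : Baire} {x : X}
    (h : ∀ i, dist (ν (q i)) x < (1 / 2 : ℝ) ^ (i + 1)) : cauchyNaming ν q x := by
  refine ⟨fun i j => ?_, ?_⟩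
  · have hi : (1 / 2 : ℝ) ^ i ≤ (1 / 2 : ℝ) ^ min i j :=
      pow_le_pow_of_le_one (by norm_num) (by norm_num) (min_le_left i j)
    have hj : (1 / 2 : ℝ) ^ j ≤ (1 / 2 : ℝ) ^ min i j :=
      pow_le_pow_of_le_one (by norm_num) (by norm_num) (min_le_right i j)
    have h1 := h i
    have h2 := h j
    rw [pow_succ] at h1 h2
    linarith [dist_triangle_right (ν (q i)) (ν (q j)) x]
  · refine tendsto_iff_dist_tendsto_zero.2 (squeeze_zero (fun _ => dist_nonneg)
      (fun i => (h i).le) ?_)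
    exact (tendsto_pow_atTop_nhds_zero_of_lt_one (by norm_num) (by norm_num)).comp
      (tendsto_add_atTop_nat 1)

/-- The finitely many strict inequalities leave a common slack `ε`. The prefix can be continued by a
name of `y` whose entries are all within `ε` of `y`. -/
theorem exists_cauchyNaming_eq_of_lt (hν : DenseRange ν) {q : Baire} {k : ℕ} {y : X}
    (hq : ∀ i < k, ∀ j < k, dist (ν (q i)) (ν (q j)) < (1 / 2 : ℝ) ^ (min i j))
    (hy : ∀ i < k, dist (ν (q i)) y < (1 / 2 : ℝ) ^ i) :
    ∃ q' : Baire, cauchyNaming ν q' y ∧ ∀ i < k, q' i = q i := by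
  obtain ⟨ε, hε, hεk⟩ : ∃ ε > 0, ∀ i < k, dist (ν (q i)) y + ε ≤ (1 / 2 : ℝ) ^ i := by
    induction k with
    | zero => exact ⟨1, one_pos, by simp⟩
    | succ k ih =>
      obtain ⟨ε, hε, h⟩ := ih (fun i hi j hj => hq i (by omega) j (by omega))
        fun i hi => hy i (by omega)
      refine ⟨min ε ((1 / 2 : ℝ) ^ k - dist (ν (q k)) y),
        lt_min hε (sub_pos.2 (hy k k.lt_succ_self)), fun i hi => ?_⟩
      rcases Nat.lt_succ_iff_lt_or_eq.1 hi with hi | rfl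
      · linarith [h i hi, min_le_left ε ((1 / 2 : ℝ) ^ k - dist (ν (q k)) y)]
      · linarith [min_le_right ε ((1 / 2 : ℝ) ^ i - dist (ν (q i)) y)]
  have hpos : ∀ i : ℕ, (0 : ℝ) < (1 / 2) ^ (i + 1) := fun i => by positivity
  have happ : ∀ i, ∃ m, dist (ν m) y < min ε ((1 / 2 : ℝ) ^ (i + 1)) := fun i => by
    obtain ⟨m, hm⟩ := hν.exists_dist_lt y (lt_min hε (hpos i))
    exact ⟨m, by rwa [dist_comm]⟩
  choose a ha using happ
  have hae : ∀ i, dist (ν (a i)) y < ε := fun i => (ha i).trans_le (min_le_left _ _)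
  have hap : ∀ i, dist (ν (a i)) y < (1 / 2 : ℝ) ^ (i + 1) := fun i =>
    (ha i).trans_le (min_le_right _ _)
  have hac := cauchyNaming.of_dist_lt hap
  refine ⟨fun i => if i < k then q i else a i, ⟨fun i j => ?_, ?_⟩, fun i hi => if_pos hi⟩
  · by_cases hi : i < k <;> by_cases hj : j < k <;> simp only [hi, hj, if_true, if_false]
    · exact hq i hi j hj
    · rw [min_eq_left (by omega)]
      linarith [hεk i hi, hae j, dist_triangle_right (ν (q i)) (ν (a j)) y]
    · rw [min_eq_right (by omega)]
      linarith [hεk j hj, hae i, dist_triangle_right (ν (a i)) (ν (q j)) y,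
        dist_comm (ν (q j)) y]
    · exact hac.1 i j
  · refine hac.2.congr' ?_
    filter_upwards [eventually_ge_atTop k] with i hi
    rw [if_neg (not_lt.2 hi)]

theorem exists_cauchyNaming_dist_lt (hν : DenseRange ν) (x : X) :
    ∃ q : Baire, cauchyNaming ν q x ∧ ∀ i, dist (ν (q i)) x < (1 / 2 : ℝ) ^ (i + 1) := by
  have happ : ∀ i : ℕ, ∃ m, dist (ν m) x < (1 / 2 : ℝ) ^ (i + 1) := fun i => by
    obtain ⟨m, hm⟩ := hν.exists_dist_lt x (show (0 : ℝ) < (1 / 2) ^ (i + 1) by positivity)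
    exact ⟨m, by rwa [dist_comm]⟩
  choose q hq using happ
  exact ⟨q, cauchyNaming.of_dist_lt hq, hq⟩

/-- The accelerated name `i ↦ q (i + 1)`. -/
theorem cauchyNaming.shift {q : Baire} {x : X} (h : cauchyNaming ν q x) :
    cauchyNaming ν (fun i => q (i + 1)) x := by
  refine ⟨fun i j => (h.1 _ _).trans_le ?_, h.2.comp (tendsto_add_atTop_nat 1)⟩
  exact pow_le_pow_of_le_one (by norm_num) (by norm_num) (by omega)

theorem Realizes.exists_decides {f : X →. Y} {P q : Baire} {x : X} {v : Y}
    (hP : Realizes (cauchyNaming ν) (cauchyNaming μ) (eta P) f) (hq : cauchyNaming ν q x)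
    (hv : v ∈ f x) (n : ℕ) : ∃ k m, Decides P q n k m := by
  obtain ⟨r, hr, -⟩ := hP q x v hq hv
  obtain ⟨k, hk⟩ := exists_decides_of_mem_eta hr n
  exact ⟨k, _, hk⟩

theorem Realizes.dist_le_of_decides {f : X →. Y} {P q : Baire} {x : X} {v : Y}
    (hP : Realizes (cauchyNaming ν) (cauchyNaming μ) (eta P) f) (hq : cauchyNaming ν q x)
    (hv : v ∈ f x) {n k m : ℕ} (hd : Decides P q n k m) :
    dist (μ m) v ≤ (1 / 2 : ℝ) ^ n := by
  obtain ⟨r, hr, hrv⟩ := hP q x v hq hv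
  rw [← eq_of_mem_eta_of_decides hr hd]
  exact hrv.dist_le n

/-- A decision made on a prefix holds for all points close to that prefix. -/
theorem Realizes.dist_le_of_decides_of_lt (hν : DenseRange ν) {f : X →. Y} {P q : Baire} {x y : X}
    {v : Y} (hP : Realizes (cauchyNaming ν) (cauchyNaming μ) (eta P) f) (hq : cauchyNaming ν q x)
    {n k m : ℕ} (hd : Decides P q n k m) (hy : ∀ i < k, dist (ν (q i)) y < (1 / 2 : ℝ) ^ i)
    (hv : v ∈ f y) : dist (μ m) v ≤ (1 / 2 : ℝ) ^ n := by
  obtain ⟨q', hq', h⟩ := exists_cauchyNaming_eq_of_lt hν (fun i _ j _ => hq.1 i j) hy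
  exact hP.dist_le_of_decides hq' hv (hd.congr fun i hi => (h i hi).symm)

theorem IsRelContinuous.continuousOn_val [Zero Y] (hν : DenseRange ν) {f : X →. Y}
    (hf : IsRelContinuous (cauchyNaming ν) (cauchyNaming μ) f) : ContinuousOn f.val f.Dom := by
  obtain ⟨P, hP⟩ := hf
  intro x hx
  refine Metric.tendsto_nhds.2 fun ε hε => ?_
  obtain ⟨n, hn⟩ := exists_pow_lt_of_lt_one (half_pos hε) (show (1 / 2 : ℝ) < 1 by norm_num)
  -- A name with twice the required precision leaves room for a whole ball around `x`, of radius `(1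
  -- / 2) ^ (k + 1)`, to be compatible with its first `k` entries.
  obtain ⟨q, hq, hqx⟩ := exists_cauchyNaming_dist_lt hν x
  obtain ⟨k, m, hd⟩ := hP.exists_decides hq (PFun.val_mem hx) n
  have hmx := hP.dist_le_of_decides hq (PFun.val_mem hx) hd
  have hpos : (0 : ℝ) < (1 / 2) ^ (k + 1) := by positivity
  filter_upwards [self_mem_nhdsWithin, mem_nhdsWithin_of_mem_nhds (Metric.ball_mem_nhds x hpos)]
    with y hy hyx
  have hmy := hP.dist_le_of_decides_of_lt hν hq hd (y := y) (fun i hi => ?_) (PFun.val_mem hy)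
  · linarith [dist_triangle_left (f.val y) (f.val x) (μ m)]
  · have h1 := hqx i
    have h2 : (1 / 2 : ℝ) ^ (k + 1) ≤ (1 / 2 : ℝ) ^ (i + 1) :=
      pow_le_pow_of_le_one (by norm_num) (by norm_num) (by omega)
    rw [Metric.mem_ball, dist_comm] at hyx
    have h3 : (1 / 2 : ℝ) ^ (i + 1) = (1 / 2 : ℝ) ^ i / 2 := by ring
    linarith [dist_triangle (ν (q i)) x y]

end CauchyNames

/-! ### The retraction -/

section Retraction

theorem finsum_val_mul_val_eq_sum {X R : Type*} [NonUnitalNonAssocSemiring R] {y : ℕ → X}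
    {f : ℕ → X →. R} {h : X →. R} {x : X} {s : Finset ℕ} (hs : ∀ i, (f i).val x ≠ 0 → i ∈ s) :
    ∑ᶠ i, h.val (y i) * (f i).val x = ∑ i ∈ s, h.val (y i) * (f i).val x :=
  finsum_eq_sum_of_support_subset _ fun i hi => hs i (right_ne_zero_of_mul hi)

theorem val_retract_of_mem {X : Type*} [Nonempty X] {p : ℕ} [Fact p.Prime] {A : Set X} {y : ℕ → X}
    {f : ℕ → X →. ℚ_[p]} {h : X →. ℚ_[p]} {x : X} (hx : x ∈ A) :
    h.val (retract A y f h x) = h.val x := by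
  rw [retract, if_pos hx]

variable {X : Type*} [MetricSpace X] {ν : ℕ → X} {p : ℕ} [Fact p.Prime] {A : Set X}
  {V : ℕ → Set X} {y : ℕ → X} {f : ℕ → X →. ℚ_[p]} {h : X →. ℚ_[p]}

namespace ThetaDom

theorem iUnion_eq (H : ThetaDom ν A V y f h) : (⋃ i, V i) = Aᶜ := by
  rw [← H.compl_eq, compl_compl]

theorem isDugundjiSystem (H : ThetaDom ν A V y f h) : IsDugundjiSystem ν 1 A V y := by
  have := H.mem_systems
  rwa [DugundjiSystems, mem_ofPred_eq, H.compl_eq] at this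

theorem mem_iUnion (H : ThetaDom ν A V y f h) {x : X} (hx : x ∉ A) : x ∈ ⋃ i, V i := by
  rw [H.iUnion_eq]; exact hx

/-- `finsum` is `0` by convention on infinite supports, whereas the sum is `1`. -/
theorem support_finite (H : ThetaDom ν A V y f h) {x : X} (hx : x ∉ A) :
    (Function.support fun i => (f i).val x).Finite := by
  by_contra hinf
  have := H.partition.sum_eq_one x (H.mem_iUnion hx)
  rw [finsum_of_infinite_support hinf] at this
  exact zero_ne_one this

theorem dist_le (H : ThetaDom ν A V y f h) {x : X} (hx : x ∉ A) {i : ℕ} (hi : (f i).val x ≠ 0) :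
    dist x (y i) ≤ 2 * Metric.infDist x A := by
  have := H.isDugundjiSystem.dist_le i x (H.partition.subordinate i x (H.mem_iUnion hx) hi)
  linarith

/-- Since the `f i x` sum to one, `d` can be moved inside the sum; the ultrametric inequality bounds
the sum by its largest term. -/
theorem norm_finsum_sub_le (H : ThetaDom ν A V y f h) {x : X} (hx : x ∉ A) {d : ℚ_[p]} {ρ : ℝ}
    (hρ : 0 ≤ ρ) (hd : ∀ i, (f i).val x ≠ 0 → ‖h.val (y i) - d‖ ≤ ρ) :
    ‖∑ᶠ i, h.val (y i) * (f i).val x - d‖ ≤ ρ := by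
  have hfin := H.support_finite hx
  have hs : ∀ i, (f i).val x ≠ 0 → i ∈ hfin.toFinset := fun i hi => by simpa using hi
  have hone : ∑ i ∈ hfin.toFinset, (f i).val x = 1 := by
    rw [← H.partition.sum_eq_one x (H.mem_iUnion hx)]
    exact (finsum_eq_sum _ hfin).symm
  have : ∑ᶠ i, h.val (y i) * (f i).val x - d =
      ∑ i ∈ hfin.toFinset, (h.val (y i) - d) * (f i).val x := by
    simp_rw [finsum_val_mul_val_eq_sum hs, sub_mul, Finset.sum_sub_distrib, ← Finset.mul_sum, hone,
      mul_one]
  rw [this]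
  refine IsUltrametricDist.norm_sum_le_of_forall_le_of_nonneg hρ fun i hi => ?_
  rw [norm_mul]
  have h1 := H.partition.norm_le_one i x (H.mem_iUnion hx)
  have h2 := hd i (by simpa using hi)
  exact (mul_le_of_le_one_right (norm_nonneg _) h1).trans h2

/-- Fix `i` in the support and let `h (y j)` be farthest from `h (y i)` among the indices of the
support. The sum is then in the closed ball around `h (y i)` through `h (y j)`, which convexity
places in `h(A)`. -/
theorem finsum_mem (H : ThetaDom ν A V y f h) {x : X} (hx : x ∉ A) :
    ∑ᶠ i, h.val (y i) * (f i).val x ∈ h.val '' A := by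
  have hfin := H.support_finite hx
  have hne : hfin.toFinset.Nonempty := by
    by_contra hemp
    rw [Finset.not_nonempty_iff_eq_empty] at hemp
    have := H.partition.sum_eq_one x (H.mem_iUnion hx)
    rw [finsum_eq_sum _ hfin, hemp, Finset.sum_empty] at this
    exact zero_ne_one this
  obtain ⟨i, -⟩ := id hne
  obtain ⟨j, -, hj⟩ := hfin.toFinset.exists_max_image (fun j => ‖h.val (y j) - h.val (y i)‖) hne
  refine H.homeo.convex (h.val (y i)) ⟨_, H.isDugundjiSystem.mem i, rfl⟩ (h.val (y j))
    ⟨_, H.isDugundjiSystem.mem j, rfl⟩ ?_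
  rw [Metric.mem_closedBall, dist_eq_norm, dist_comm, dist_eq_norm]
  exact H.norm_finsum_sub_le hx (norm_nonneg _) fun k hk => hj k (by simpa using hk)

theorem continuousOn_val (H : ThetaDom ν A V y f h) : ContinuousOn h.val A :=
  continuousOn_iff_continuous_domRestrict.2 H.homeo.isEmbedding.continuous

variable [Nonempty X]

theorem val_retract_of_notMem (H : ThetaDom ν A V y f h) {x : X} (hx : x ∉ A) :
    h.val (retract A y f h x) = ∑ᶠ i, h.val (y i) * (f i).val x := by
  rw [retract, if_neg hx]
  exact Function.invFunOn_eq (H.finsum_mem hx)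

theorem retract_mem (H : ThetaDom ν A V y f h) (x : X) : retract A y f h x ∈ A := by
  by_cases hx : x ∈ A
  · rwa [retract, if_pos hx]
  · rw [retract, if_neg hx]
    exact Function.invFunOn_mem (H.finsum_mem hx)

/-- The value of `h ∘ r` at `x` is an ultrametric mean of the values of `h` on the points of `A`
that are almost closest to `x`. -/
theorem norm_val_retract_sub_le (H : ThetaDom ν A V y f h) {x : X} {d : ℚ_[p]} {ρ : ℝ}
    (hρ : 0 ≤ ρ) (hd : ∀ a ∈ A, dist x a ≤ 2 * Metric.infDist x A → ‖h.val a - d‖ ≤ ρ) :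
    ‖h.val (retract A y f h x) - d‖ ≤ ρ := by
  by_cases hx : x ∈ A
  · rw [val_retract_of_mem hx]
    exact hd x hx (by simp [Metric.infDist_nonneg])
  · rw [H.val_retract_of_notMem hx]
    exact H.norm_finsum_sub_le hx hρ fun i hi => hd _ (H.isDugundjiSystem.mem i) (H.dist_le hx hi)

theorem continuous_val_retract (hν : DenseRange ν) (H : ThetaDom ν A V y f h) :
    Continuous fun x => h.val (retract A y f h x) := by
  refine continuous_iff_continuousAt.2 fun x => ?_
  by_cases hx : x ∈ A
  · refine Metric.continuousAt_iff.2 fun ε hε => ?_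
    obtain ⟨δ, hδ, hδε⟩ := Metric.continuousOn_iff.1 H.continuousOn_val x hx (ε / 2) (half_pos hε)
    -- An almost closest point `a` satisfies `d(x', a) ≤ 2 d(x', x)`, hence `d(a, x) ≤ 3 d(x', x) <
    -- δ`.
    refine ⟨δ / 3, by positivity, fun {x'} hx' => ?_⟩
    rw [dist_eq_norm, val_retract_of_mem hx]
    refine (H.norm_val_retract_sub_le (half_pos hε).le fun a ha hxa => ?_).trans_lt (half_lt_self hε)
    rw [← dist_eq_norm]
    refine (hδε a ha ?_).le
    have := Metric.infDist_le_dist_of_mem (x := x') hx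
    linarith [dist_triangle_left a x x']
  · obtain ⟨i, hi⟩ := Set.mem_iUnion.1 (H.mem_iUnion hx)
    obtain ⟨b, hxb, hfin⟩ := H.isDugundjiSystem.locallyFinite.2 i x hi
    have hopen : IsOpen (idealBall' ν b) := by
      cases b
      · exact isOpen_empty
      · exact Metric.isOpen_ball
    have hev : ∀ᶠ x' in 𝓝 x, x' ∈ idealBall' ν b ∩ Aᶜ :=
      (hopen.inter H.isDugundjiSystem.isClosed.isOpen_compl).mem_nhds ⟨hxb, hx⟩
    -- Near `x` only the members of the family meeting the ball contribute, so the value is a sum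
    -- over a fixed finite index set.
    have hsum : ContinuousAt (fun x' => ∑ j ∈ hfin.toFinset, h.val (y j) * (f j).val x') x := by
      refine tendsto_finsetSum _ fun j _ => tendsto_const_nhds.mul ?_
      refine ((H.partition.continuous j).continuousOn_val hν).continuousAt ?_
      rw [H.partition.dom_eq, H.iUnion_eq]
      exact H.isDugundjiSystem.isClosed.isOpen_compl.mem_nhds hx
    refine hsum.congr ?_
    filter_upwards [hev] with x' hx'
    rw [H.val_retract_of_notMem hx'.2]
    refine (finsum_val_mul_val_eq_sum fun j hj => ?_).symm
    simpa using ⟨x', H.partition.subordinate j x' (H.mem_iUnion hx'.2) hj, hx'.1⟩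

/-- As `h` embeds `A`, continuity of `h ∘ r` is continuity of `r`. -/
theorem continuous_retract (hν : DenseRange ν) (H : ThetaDom ν A V y f h) :
    Continuous (retract A y f h) := by
  have : Continuous fun x => (⟨retract A y f h x, H.retract_mem x⟩ : A) :=
    H.homeo.isEmbedding.continuous_iff.2 (H.continuous_val_retract hν)
  exact continuous_subtype_val.comp this

end ThetaDom

end Retraction

/-! ### Arithmetic on codes of rationals -/

/-- Addition on codes of rationals. -/
def ratAdd (a b : ℕ) : ℕ :=
  Nat.pair
    (Nat.pair (a.unpair.1.unpair.1 * (b.unpair.2 + 1) + b.unpair.1.unpair.1 * (a.unpair.2 + 1))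
      (a.unpair.1.unpair.2 * (b.unpair.2 + 1) + b.unpair.1.unpair.2 * (a.unpair.2 + 1)))
    ((a.unpair.2 + 1) * (b.unpair.2 + 1) - 1)

/-- Multiplication on codes of rationals. -/
def ratMul (a b : ℕ) : ℕ :=
  Nat.pair
    (Nat.pair (a.unpair.1.unpair.1 * b.unpair.1.unpair.1 + a.unpair.1.unpair.2 * b.unpair.1.unpair.2)
      (a.unpair.1.unpair.1 * b.unpair.1.unpair.2 + a.unpair.1.unpair.2 * b.unpair.1.unpair.1))
    ((a.unpair.2 + 1) * (b.unpair.2 + 1) - 1)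

/-- Strict comparison on codes of rationals. -/
def RatLt (a b : ℕ) : Prop :=
  a.unpair.1.unpair.1 * (b.unpair.2 + 1) + b.unpair.1.unpair.2 * (a.unpair.2 + 1) <
    b.unpair.1.unpair.1 * (a.unpair.2 + 1) + a.unpair.1.unpair.2 * (b.unpair.2 + 1)

/-- A code of `(1 / 2) ^ n`. -/
def halfPow (n : ℕ) : ℕ := Nat.pair (Nat.pair 1 0) (2 ^ n - 1)

/-- A code of `posRatNum a`. -/
def posRat (a : ℕ) : ℕ := Nat.pair (Nat.pair (a.unpair.1 + 1) 0) a.unpair.2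

/-- A code of the sum of a list of coded rationals. -/
def ratSum (l : List ℕ) : ℕ := l.foldr ratAdd 0

theorem ratNum_ratAdd (a b : ℕ) : ratNum (ratAdd a b) = ratNum a + ratNum b := by
  -- Codes store the denominator minus one; positivity makes the truncated subtraction exact under
  -- the cast.
  have h : 1 ≤ (a.unpair.2 + 1) * (b.unpair.2 + 1) := Nat.mul_pos (by omega) (by omega)
  simp only [ratNum, ratAdd, Nat.unpair_pair]
  push_cast [h]
  field_simp
  ring

theorem ratNum_ratMul (a b : ℕ) : ratNum (ratMul a b) = ratNum a * ratNum b := by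
  have h : 1 ≤ (a.unpair.2 + 1) * (b.unpair.2 + 1) := Nat.mul_pos (by omega) (by omega)
  simp only [ratNum, ratMul, Nat.unpair_pair]
  push_cast [h]
  field_simp
  ring

theorem ratLt_iff (a b : ℕ) : RatLt a b ↔ ratNum a < ratNum b := by
  simp only [ratNum, RatLt]
  rw [div_lt_div_iff₀ (by positivity) (by positivity), ← Nat.cast_lt (α := ℚ)]
  push_cast
  constructor <;> intro h <;> nlinarith

theorem ratNum_halfPow (n : ℕ) : ratNum (halfPow n) = (1 / 2) ^ n := by
  have h : 1 ≤ 2 ^ n := Nat.one_le_two_pow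
  simp only [ratNum, halfPow, Nat.unpair_pair]
  push_cast [h]
  simp

theorem ratNum_posRat (a : ℕ) : ratNum (posRat a) = posRatNum a := by
  simp [ratNum, posRat, posRatNum]

theorem ratNum_zero : ratNum 0 = 0 := by simp [ratNum]

theorem ratNum_ratSum (l : List ℕ) : ratNum (ratSum l) = (l.map ratNum).sum := by
  induction l with
  | nil => simp [ratSum, ratNum_zero]
  | cons a l ih => rw [List.map_cons, List.sum_cons, ← ih, ← ratNum_ratAdd]; rfl

theorem List.sum_range_getD {M : Type*} [AddCommMonoid M] (g : ℕ → M) (l : List ℕ) :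
    ∑ j ∈ Finset.range l.length, g (l.getD j 0) = (l.map g).sum := by
  induction l with
  | nil => simp
  | cons a l ih => simp [Finset.sum_range_succ', ← ih, add_comm]

theorem ratNum_surjective : Function.Surjective ratNum := fun q => by
  refine ⟨Nat.pair (Nat.pair q.num.toNat (-q.num).toNat) (q.den - 1), ?_⟩
  have h : 1 ≤ q.den := q.pos
  simp only [ratNum, Nat.unpair_pair]
  have h2 : (q.num.toNat : ℤ) - ((-q.num).toNat : ℤ) = q.num := by omega
  have h3 : (q.num.toNat : ℚ) - ((-q.num).toNat : ℚ) = q.num := by exact_mod_cast h2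
  push_cast [h]
  rw [h3, sub_add_cancel, Rat.num_div_den]

/-! ### Primitive recursiveness of the arithmetic on codes -/

section Primrec

open Primrec

theorem primrec_unpair_fst : Primrec fun a : ℕ => a.unpair.1 := Primrec.fst.comp Primrec.unpair

theorem primrec_unpair_snd : Primrec fun a : ℕ => a.unpair.2 := Primrec.snd.comp Primrec.unpair

theorem primrec_ratAdd : Primrec₂ ratAdd := by
  have n1 : Primrec fun a : ℕ => a.unpair.1.unpair.1 := primrec_unpair_fst.comp primrec_unpair_fst
  have n2 : Primrec fun a : ℕ => a.unpair.1.unpair.2 := primrec_unpair_snd.comp primrec_unpair_fst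
  have dd : Primrec fun a : ℕ => a.unpair.2 + 1 := Primrec.succ.comp primrec_unpair_snd
  exact Primrec₂.natPair.comp
    (Primrec₂.natPair.comp
      (nat_add.comp (nat_mul.comp (n1.comp fst) (dd.comp snd))
        (nat_mul.comp (n1.comp snd) (dd.comp fst)))
      (nat_add.comp (nat_mul.comp (n2.comp fst) (dd.comp snd))
        (nat_mul.comp (n2.comp snd) (dd.comp fst))))
    (pred.comp (nat_mul.comp (dd.comp fst) (dd.comp snd)))

theorem primrec_ratMul : Primrec₂ ratMul := by
  have n1 : Primrec fun a : ℕ => a.unpair.1.unpair.1 := primrec_unpair_fst.comp primrec_unpair_fst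
  have n2 : Primrec fun a : ℕ => a.unpair.1.unpair.2 := primrec_unpair_snd.comp primrec_unpair_fst
  have dd : Primrec fun a : ℕ => a.unpair.2 + 1 := Primrec.succ.comp primrec_unpair_snd
  exact Primrec₂.natPair.comp
    (Primrec₂.natPair.comp
      (nat_add.comp (nat_mul.comp (n1.comp fst) (n1.comp snd))
        (nat_mul.comp (n2.comp fst) (n2.comp snd)))
      (nat_add.comp (nat_mul.comp (n1.comp fst) (n2.comp snd))
        (nat_mul.comp (n2.comp fst) (n1.comp snd))))
    (pred.comp (nat_mul.comp (dd.comp fst) (dd.comp snd)))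

theorem primrecRel_ratLt : PrimrecRel RatLt := by
  have n1 : Primrec fun a : ℕ => a.unpair.1.unpair.1 := primrec_unpair_fst.comp primrec_unpair_fst
  have n2 : Primrec fun a : ℕ => a.unpair.1.unpair.2 := primrec_unpair_snd.comp primrec_unpair_fst
  have dd : Primrec fun a : ℕ => a.unpair.2 + 1 := Primrec.succ.comp primrec_unpair_snd
  exact nat_lt.comp
    (nat_add.comp (nat_mul.comp (n1.comp fst) (dd.comp snd))
      (nat_mul.comp (n2.comp snd) (dd.comp fst)))
    (nat_add.comp (nat_mul.comp (n1.comp snd) (dd.comp fst))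
      (nat_mul.comp (n2.comp fst) (dd.comp snd)))

theorem primrec_two_pow : Primrec fun n : ℕ => 2 ^ n := by
  refine (nat_rec₁ (f := fun _ r : ℕ => 2 * r) 1
    (nat_mul.comp (Primrec.const 2) snd)).of_eq fun n => ?_
  induction n with
  | zero => rfl
  | succ n ih => rw [pow_succ', ← ih]

theorem primrec_halfPow : Primrec halfPow :=
  Primrec₂.natPair.comp (Primrec.const _) (pred.comp primrec_two_pow)

theorem primrec_posRat : Primrec posRat :=
  Primrec₂.natPair.comp
    (Primrec₂.natPair.comp (Primrec.succ.comp primrec_unpair_fst) (Primrec.const 0))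
    primrec_unpair_snd

theorem primrec_ratSum : Primrec ratSum :=
  list_foldr Primrec.id (Primrec.const 0)
    (primrec_ratAdd.comp (fst.comp snd) (snd.comp snd)).to₂

end Primrec

/-! ### Norms of rationals in `ℚ_p` -/

section Padic

variable {p : ℕ} [Fact p.Prime]

/-- Each factor `p` of `n` divides the norm by `p` but multiplies `n` by `p`; the part of `n` prime
to `p` has norm one. -/
theorem Padic.one_le_natCast_mul_norm {n : ℕ} (hn : n ≠ 0) : 1 ≤ (n : ℝ) * ‖(n : ℚ_[p])‖ := by
  induction n using Nat.strong_induction_on with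
  | _ n ih =>
    by_cases hp : p ∣ n
    · obtain ⟨m, rfl⟩ := hp
      have hp0 : p ≠ 0 := (Fact.out : p.Prime).ne_zero
      have hm : m ≠ 0 := right_ne_zero_of_mul hn
      have h1 := ih m (lt_mul_left (Nat.pos_of_ne_zero hm) (Fact.out : p.Prime).one_lt) hm
      have h2 : (p : ℝ) ≠ 0 := Nat.cast_ne_zero.2 hp0
      rw [Nat.cast_mul, Nat.cast_mul, norm_mul, Padic.norm_p]
      calc (1 : ℝ) ≤ m * ‖(m : ℚ_[p])‖ := h1
        _ = p * m * ((p : ℝ)⁻¹ * ‖(m : ℚ_[p])‖) := by field_simp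
    · have : ‖(n : ℚ_[p])‖ = 1 := by
        rw [← Rat.cast_natCast, Padic.eq_padicNorm, (padicNorm.nat_eq_one_iff n).2 hp, Rat.cast_one]
      rw [this, mul_one]
      exact_mod_cast Nat.one_le_iff_ne_zero.2 hn

/-- A bound read off the code, which avoids computing valuations when the precision of a factor is
chosen. -/
theorem Padic.norm_ratNum_le (b : ℕ) : ‖(ratNum b : ℚ_[p])‖ ≤ (b.unpair.2 : ℝ) + 1 := by
  have h1 := Padic.one_le_natCast_mul_norm (p := p) (Nat.succ_ne_zero b.unpair.2)
  have h2 := Padic.norm_int_le_one (p := p) ((b.unpair.1.unpair.1 : ℤ) - b.unpair.1.unpair.2)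
  have h3 : (ratNum b : ℚ_[p]) = (((b.unpair.1.unpair.1 : ℤ) - b.unpair.1.unpair.2 : ℤ) : ℚ_[p]) /
      ((b.unpair.2.succ : ℕ) : ℚ_[p]) := by
    simp [ratNum]
  have h4 : 0 < ‖((b.unpair.2.succ : ℕ) : ℚ_[p])‖ :=
    norm_pos_iff.2 (Nat.cast_ne_zero.2 (Nat.succ_ne_zero _))
  rw [h3, norm_div, div_le_iff₀ h4]
  refine h2.trans (h1.trans (le_of_eq ?_))
  push_cast
  ring

/-- The error of a product of approximations, the first factor being integral. -/
theorem Padic.norm_mul_sub_mul_le {a b u v : ℚ_[p]} {ε δ M : ℝ} (hu : ‖u‖ ≤ 1) (hb : ‖b‖ ≤ M)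
    (hv : ‖b - v‖ ≤ ε) (ha : ‖a - u‖ ≤ δ) (hM : M * δ ≤ ε) : ‖a * b - v * u‖ ≤ ε := by
  have h : a * b - v * u = u * (b - v) + b * (a - u) := by ring
  rw [h]
  refine (Padic.nonarchimedean _ _).trans (max_le ?_ ?_)
  · rw [norm_mul]
    exact (mul_le_of_le_one_left (norm_nonneg _) hu).trans hv
  · rw [norm_mul]
    refine (mul_le_mul hb ha (norm_nonneg _) ((norm_nonneg _).trans hb)).trans hM

end Padic

/-- A strict inequality is witnessed by an approximation that satisfies it even after its error
bound is added. -/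
theorem IsComputableMetricSpace.isSemidecidable_dist_lt {X : Type*} [MetricSpace X] {ν : ℕ → X}
    (hν : IsComputableMetricSpace ν) : IsSemidecidable fun (x : (ℕ × ℕ) × ℕ) _ _ =>
      dist (ν x.1.1) (ν x.1.2) < (ratNum x.2 : ℝ) := by
  obtain ⟨g, hg, hd⟩ := hν.computable_dist
  have hlt : IsSemidecidable fun (x : ℕ × ℕ) _ _ => RatLt x.1 x.2 :=
    IsSemidecidable.of_primrecPred (primrecRel_ratLt.comp Primrec.fst Primrec.snd)
  have hcode : Computable fun x : ((ℕ × ℕ) × ℕ) × ℕ =>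
      (ratAdd (g (x.1.1.1, x.1.1.2, x.2)) (halfPow x.2), x.1.2) := by
    refine Computable.pair (primrec_ratAdd.to_comp.comp (hg.comp ?_)
      (primrec_halfPow.to_comp.comp Computable.snd)) (Computable.snd.comp Computable.fst)
    have h11 : Computable fun x : ((ℕ × ℕ) × ℕ) × ℕ => x.1.1 :=
      Computable.fst.comp Computable.fst
    exact (Computable.fst.comp h11).pair ((Computable.snd.comp h11).pair Computable.snd)
  refine (hlt.comp hcode).exists_nat.of_iff fun x _ _ => ?_
  simp only [ratLt_iff, ratNum_ratAdd, ratNum_halfPow]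
  simp only [← Rat.cast_lt (K := ℝ)]
  push_cast
  constructor
  · intro h
    obtain ⟨m, hm⟩ := exists_pow_lt_of_lt_one (half_pos (sub_pos.2 h))
      (show (1 / 2 : ℝ) < 1 by norm_num)
    exact ⟨m, by linarith [(abs_le.1 (hd x.1.1 x.1.2 m)).1]⟩
  · rintro ⟨m, hm⟩
    linarith [(abs_le.1 (hd x.1.1 x.1.2 m)).2]

/-! ### The components of an input of `θ` -/

namespace ThetaInput

/-- The name of the `i`-th point of the dense sequence in `A`. -/
def densePoint (s : Baire) (i : ℕ) : Baire := comp (fst (fst s)) i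

/-- The sequence of codes of ideal balls exhausting the complement of `A`. -/
def ballCode (s : Baire) : Baire := fst (snd (fst (fst (snd s))))

/-- The sequence of codes of finite sets of indices. -/
def indexCode (s : Baire) : Baire := snd (snd (fst (fst (snd s))))

/-- The name of the point `y i` of the Dugundji system. -/
def point (s : Baire) (i : ℕ) : Baire := comp (snd (fst (snd s))) i

/-- The realizer of the `i`-th function of the partition of unity. -/
def partitionTable (s : Baire) (i : ℕ) : Baire := fst (comp (fst (snd (snd s))) i)

/-- The realizer of the homeomorphism `h`. -/
def homeoTable (s : Baire) : Baire := fst (snd (snd (snd s)))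

/-- `e` codes a product of approximations of `f j x` and `h (y j)`, with error at most
`(1 / 2) ^ n`. -/
def ApproxTerm (s q : Baire) (j n e : ℕ) : Prop :=
  ∃ w : (ℕ × ℕ × ℕ) × ℕ × ℕ, Decides (partitionTable s j) q w.1.1 w.1.2.1 w.1.2.2 ∧
    Decides (homeoTable s) (point s j) n w.2.1 w.2.2 ∧
    -- The code bounds the norm of the approximation of `h (y j)`, so the error of the other factor,
    -- multiplied by it, stays below `(1 / 2) ^ n`.
    (w.2.2.unpair.2 + 1) * 2 ^ n ≤ 2 ^ w.1.1 ∧ e = ratMul w.1.2.2 w.2.2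

/-- Off `A`, the value of `h ∘ r` is approximated by a finite sum. -/
def FarApprox {X : Type*} [MetricSpace X] (ν : ℕ → X) (s q : Baire) (n d : ℕ) : Prop :=
  ∃ w : List ℕ × (ℕ × ℕ) × ℕ × ℕ × ℕ, ballCode s w.2.1.1 = w.2.1.2 + 1 ∧
    q w.2.2.1 = w.2.2.2.1 ∧
    dist (ν w.2.2.2.1) (ν w.2.1.2.unpair.1) < (ratNum w.2.2.2.2 : ℝ) ∧
    RatLt (ratAdd w.2.2.2.2 (halfPow w.2.2.1)) (posRat w.2.1.2.unpair.2) ∧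
    -- The binary code of the finite set itself serves as the number of terms, see `lt_indexCode`.
    indexCode s w.2.1.1 = w.1.length ∧
    (∀ j < w.1.length, ApproxTerm s q j n (w.1.getD j 0)) ∧ d = ratSum w.1

/-- Close to `A`, the value of `h ∘ r` is approximated by running `h` on a prefix of the
name of the argument. -/
def NearApprox {X : Type*} [MetricSpace X] (ν : ℕ → X) (s q : Baire) (n d : ℕ) : Prop :=
  ∃ w : (ℕ × ℕ) × ℕ × ℕ, Decides (homeoTable s) (fun i => q (i + 1)) n w.1.1 d ∧
    -- With `k = w.1.1`, two errors `(1 / 2) ^ (k + 4)` and the tested bound `(1 / 2) ^ (k + 2)` add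
    -- up to less than `(1 / 2) ^ (k + 1)`.
    q (w.1.1 + 4) = w.2.1 ∧ densePoint s w.1.2 (w.1.1 + 4) = w.2.2 + 1 ∧
    dist (ν w.2.1) (ν w.2.2) < (ratNum (halfPow (w.1.1 + 2)) : ℝ)

/-! ### Semidecidability of the certificates -/

theorem isSemidecidable_approxTerm :
    IsSemidecidable fun (x : (ℕ × ℕ) × ℕ) s q => ApproxTerm s q x.1.1 x.1.2 x.2 := by
  let α := ((ℕ × ℕ) × ℕ) × (ℕ × ℕ × ℕ) × ℕ × ℕ
  have h1 : Computable fun x : α => x.1.1 := Computable.fst.comp Computable.fst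
  have h21 : Computable fun x : α => x.2.1 := Computable.fst.comp Computable.snd
  have h212 : Computable fun x : α => x.2.1.2 := Computable.snd.comp h21
  have h22 : Computable fun x : α => x.2.2 := Computable.snd.comp Computable.snd
  have hj : Computable fun x : α => x.1.1.1 := Computable.fst.comp h1
  have hn : Computable fun x : α => x.1.1.2 := Computable.snd.comp h1
  have hF : IsSemidecidable fun (x : α) s q =>
      Decides (partitionTable s x.1.1.1) q x.2.1.1 x.2.1.2.1 x.2.1.2.2 :=
    IsOracleComputable.decides (IsOracleComputable.left.snd.snd.fst.comp hj).fst
      IsOracleComputable.right (Computable.fst.comp h21) (Computable.fst.comp h212)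
      (Computable.snd.comp h212)
  have hH : IsSemidecidable fun (x : α) s _ =>
      Decides (homeoTable s) (point s x.1.1.1) x.1.1.2 x.2.2.1 x.2.2.2 :=
    IsOracleComputable.decides IsOracleComputable.left.snd.snd.snd.fst
      (IsOracleComputable.left.snd.fst.snd.comp hj) hn (Computable.fst.comp h22)
      (Computable.snd.comp h22)
  have hM : IsSemidecidable fun (x : α) _ _ => (x.2.2.2.unpair.2 + 1) * 2 ^ x.1.1.2 ≤ 2 ^ x.2.1.1 :=
    (IsSemidecidable.of_primrecPred (Primrec.nat_le.comp Primrec.fst Primrec.snd)).comp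
      (f := fun x : α => ((x.2.2.2.unpair.2 + 1) * 2 ^ x.1.1.2, 2 ^ x.2.1.1))
      ((Primrec.nat_mul.to_comp.comp
        (Computable.succ.comp (primrec_unpair_snd.to_comp.comp (Computable.snd.comp h22)))
        (primrec_two_pow.to_comp.comp hn)).pair
        (primrec_two_pow.to_comp.comp (Computable.fst.comp h21)))
  have hE : IsSemidecidable fun (x : α) _ _ => x.1.2 = ratMul x.2.1.2.2 x.2.2.2 :=
    (IsSemidecidable.of_primrecPred (Primrec.eq.comp Primrec.fst Primrec.snd)).comp
      (f := fun x : α => (x.1.2, ratMul x.2.1.2.2 x.2.2.2))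
      ((Computable.snd.comp Computable.fst).pair (primrec_ratMul.to_comp.comp
        (Computable.snd.comp h212) (Computable.snd.comp h22)))
  exact (hF.and (hH.and (hM.and hE))).exists_denumerable

variable {X : Type*} [MetricSpace X] {ν : ℕ → X}

theorem isSemidecidable_farApprox (hν : IsComputableMetricSpace ν) :
    IsSemidecidable fun (x : ℕ × ℕ) s q => FarApprox ν s q x.1 x.2 := by
  let α := (ℕ × ℕ) × List ℕ × (ℕ × ℕ) × ℕ × ℕ × ℕ
  have hl : Computable fun x : α => x.2.1 := Computable.fst.comp Computable.snd
  have h22 : Computable fun x : α => x.2.2 := Computable.snd.comp Computable.snd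
  have hba : Computable fun x : α => x.2.2.1 := Computable.fst.comp h22
  have ha : Computable fun x : α => x.2.2.1.2 := Computable.snd.comp hba
  have h222 : Computable fun x : α => x.2.2.2 := Computable.snd.comp h22
  have ht : Computable fun x : α => x.2.2.2.1 := Computable.fst.comp h222
  have hcr : Computable fun x : α => x.2.2.2.2 := Computable.snd.comp h222
  have h1 : IsSemidecidable fun (x : α) s _ => ballCode s x.2.2.1.1 = x.2.2.1.2 + 1 :=
    IsOracleComputable.left.snd.fst.fst.snd.fst.eval_eq (Computable.fst.comp hba)
      (Computable.succ.comp ha)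
  have h2 : IsSemidecidable fun (x : α) _ q => q x.2.2.2.1 = x.2.2.2.2.1 :=
    IsSemidecidable.right ht (Computable.fst.comp hcr)
  have h3 : IsSemidecidable fun (x : α) _ _ =>
      dist (ν x.2.2.2.2.1) (ν x.2.2.1.2.unpair.1) < (ratNum x.2.2.2.2.2 : ℝ) :=
    hν.isSemidecidable_dist_lt.comp
      (f := fun x : α => ((x.2.2.2.2.1, x.2.2.1.2.unpair.1), x.2.2.2.2.2))
      (((Computable.fst.comp hcr).pair (primrec_unpair_fst.to_comp.comp ha)).pair
        (Computable.snd.comp hcr))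
  have h4 : IsSemidecidable fun (x : α) _ _ =>
      RatLt (ratAdd x.2.2.2.2.2 (halfPow x.2.2.2.1)) (posRat x.2.2.1.2.unpair.2) :=
    (IsSemidecidable.of_primrecPred (primrecRel_ratLt.comp Primrec.fst Primrec.snd)).comp
      (f := fun x : α => (ratAdd x.2.2.2.2.2 (halfPow x.2.2.2.1), posRat x.2.2.1.2.unpair.2))
      ((primrec_ratAdd.to_comp.comp (Computable.snd.comp hcr)
        (primrec_halfPow.to_comp.comp ht)).pair
        (primrec_posRat.to_comp.comp (primrec_unpair_snd.to_comp.comp ha)))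
  have h5 : IsSemidecidable fun (x : α) s _ => indexCode s x.2.2.1.1 = x.2.1.length :=
    IsOracleComputable.left.snd.fst.fst.snd.snd.eval_eq (Computable.fst.comp hba)
      (Computable.list_length.comp hl)
  have h6 : IsSemidecidable fun (x : α) s q =>
      ∀ j < x.2.1.length, ApproxTerm s q j x.1.1 (x.2.1.getD j 0) :=
    IsSemidecidable.forall_lt
      (R := fun (x : α × ℕ) s q => ApproxTerm s q x.2 x.1.1.1 (x.1.2.1.getD x.2 0))
      (isSemidecidable_approxTerm.comp
        (f := fun x : α × ℕ => ((x.2, x.1.1.1), x.1.2.1.getD x.2 0))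
        ((Computable.snd.pair (Computable.fst.comp (Computable.fst.comp Computable.fst))).pair
          ((Primrec.list_getD 0).to_comp.comp (hl.comp Computable.fst) Computable.snd)))
      (Computable.list_length.comp hl)
  have h7 : IsSemidecidable fun (x : α) _ _ => x.1.2 = ratSum x.2.1 :=
    (IsSemidecidable.of_primrecPred (Primrec.eq.comp Primrec.fst Primrec.snd)).comp
      (f := fun x : α => (x.1.2, ratSum x.2.1))
      ((Computable.snd.comp Computable.fst).pair (primrec_ratSum.to_comp.comp hl))
  exact (h1.and (h2.and (h3.and (h4.and (h5.and (h6.and h7)))))).exists_denumerable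

theorem isSemidecidable_nearApprox (hν : IsComputableMetricSpace ν) :
    IsSemidecidable fun (x : ℕ × ℕ) s q => NearApprox ν s q x.1 x.2 := by
  let α := (ℕ × ℕ) × (ℕ × ℕ) × ℕ × ℕ
  have h21 : Computable fun x : α => x.2.1 := Computable.fst.comp Computable.snd
  have hk : Computable fun x : α => x.2.1.1 := Computable.fst.comp h21
  have h22 : Computable fun x : α => x.2.2 := Computable.snd.comp Computable.snd
  have hadd : ∀ c, Computable fun x : α => x.2.1.1 + c := fun c =>
    (Primrec.nat_add.to_comp.comp hk (Computable.const c))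
  have h1 : IsSemidecidable fun (x : α) s q =>
      Decides (homeoTable s) (fun i => q (i + 1)) x.1.1 x.2.1.1 x.1.2 :=
    IsOracleComputable.decides IsOracleComputable.left.snd.snd.snd.fst
      (IsOracleComputable.right.reindex (Computable.succ.comp Computable.snd).to₂)
      (Computable.fst.comp Computable.fst) hk (Computable.snd.comp Computable.fst)
  have h2 : IsSemidecidable fun (x : α) _ q => q (x.2.1.1 + 4) = x.2.2.1 :=
    IsSemidecidable.right (hadd 4) (Computable.fst.comp h22)
  have h3 : IsSemidecidable fun (x : α) s _ =>
      densePoint s x.2.1.2 (x.2.1.1 + 4) = x.2.2.2 + 1 :=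
    (IsOracleComputable.left.fst.fst.comp (Computable.snd.comp h21)).eval_eq (hadd 4)
      (Computable.succ.comp (Computable.snd.comp h22))
  have h4 : IsSemidecidable fun (x : α) _ _ =>
      dist (ν x.2.2.1) (ν x.2.2.2) < (ratNum (halfPow (x.2.1.1 + 2)) : ℝ) :=
    hν.isSemidecidable_dist_lt.comp
      (f := fun x : α => ((x.2.2.1, x.2.2.2), halfPow (x.2.1.1 + 2)))
      (((Computable.fst.comp h22).pair (Computable.snd.comp h22)).pair
        (primrec_halfPow.to_comp.comp (hadd 2)))
  exact (h1.and (h2.and (h3.and h4))).exists_denumerable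

/-! ### Existence and soundness of the certificates -/

variable {p : ℕ} [Fact p.Prime] {A : Set X} {V : ℕ → Set X} {y : ℕ → X}
  {f : ℕ → X →. ℚ_[p]} {h : X →. ℚ_[p]} {s q : Baire} {x : X} {n d : ℕ}

theorem homeoTable_realizes (hs : thetaInputNaming p ν s (A, (V, y), f, h)) :
    Realizes (cauchyNaming ν) (padicNaming p) (eta (homeoTable s)) h :=
  hs.2.2.2.1

theorem partitionTable_realizes (hs : thetaInputNaming p ν s (A, (V, y), f, h)) (i : ℕ) :
    Realizes (cauchyNaming ν) (padicNaming p) (eta (partitionTable s i)) (f i) :=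
  (hs.2.2.1 i).1

theorem cauchyNaming_point (hs : thetaInputNaming p ν s (A, (V, y), f, h)) (i : ℕ) :
    cauchyNaming ν (point s i) (y i) :=
  hs.2.1.2.2 i

theorem iUnion_eq (hs : thetaInputNaming p ν s (A, (V, y), f, h)) :
    (⋃ j, V j) = ⋃ i, idealBall' ν (ballCode s i) :=
  hs.2.1.2.1.2.2.1

/-- Bit `j` being set forces `2 ^ j` to be at most the code, and `j < 2 ^ j`. Superfluous indices
below the code do no harm, as their functions vanish at `x`. -/
theorem lt_indexCode (hs : thetaInputNaming p ν s (A, (V, y), f, h)) {i j : ℕ}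
    (hij : (V j ∩ idealBall' ν (ballCode s i)).Nonempty) : j < indexCode s i :=
  Nat.lt_two_pow_self.trans_le (Nat.ge_two_pow_of_testBit (hs.2.1.2.1.2.2.2 i j hij))

theorem exists_dense (hs : thetaInputNaming p ν s (A, (V, y), f, h)) (hA : A.Nonempty) :
    ∃ z : ℕ → X, (∀ i, (∀ k, 1 ≤ densePoint s i k) ∧
      cauchyNaming ν (fun k => densePoint s i k - 1) (z i) ∧ z i ∈ A) ∧ A ⊆ closure (range z) := by
  rcases hs.1.1.2 with ⟨hA', -⟩ | ⟨-, hz⟩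
  · exact absurd hA' hA.ne_empty
  · exact hz

theorem val_mem_of_mem (H : ThetaDom ν A V y f h) {a : X} (ha : a ∈ A) : h.val a ∈ h a :=
  PFun.val_mem (by rwa [H.homeo.dom_eq])

theorem val_partition_mem (H : ThetaDom ν A V y f h) (hx : x ∉ A) (i : ℕ) :
    (f i).val x ∈ f i x :=
  PFun.val_mem (by rw [H.partition.dom_eq]; exact H.mem_iUnion hx)

theorem exists_nearApprox (H : ThetaDom ν A V y f h)
    (hs : thetaInputNaming p ν s (A, (V, y), f, h)) (hq : cauchyNaming ν q x) (hx : x ∈ A)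
    (n : ℕ) : ∃ d, NearApprox ν s q n d := by
  obtain ⟨k, d, hd⟩ := (homeoTable_realizes hs).exists_decides hq.shift (val_mem_of_mem H hx) n
  obtain ⟨z, hz, hdense⟩ := exists_dense hs H.nonempty
  obtain ⟨_, ⟨i, rfl⟩, hi⟩ := Metric.mem_closure_iff.1 (hdense hx) ((1 / 2) ^ (k + 4))
    (by positivity)
  refine ⟨d, ((k, i), q (k + 4), densePoint s i (k + 4) - 1), hd, rfl,
    (Nat.sub_add_cancel ((hz i).1 _)).symm, ?_⟩
  simp only [ratNum_halfPow]
  push_cast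
  have h1 := hq.dist_le (k + 4)
  have h2 := (hz i).2.1.dist_le (k + 4)
  have h3 := dist_triangle4 (ν (q (k + 4))) x (z i) (ν (densePoint s i (k + 4) - 1))
  rw [dist_comm (z i)] at h3
  have h4 : (0 : ℝ) < (1 / 2) ^ k := by positivity
  rw [pow_add] at h1 h2 hi ⊢
  linarith

theorem ApproxTerm.norm_le (H : ThetaDom ν A V y f h)
    (hs : thetaInputNaming p ν s (A, (V, y), f, h)) (hq : cauchyNaming ν q x) (hx : x ∉ A)
    {j e : ℕ} (hd : ApproxTerm s q j n e) :
    ‖(ratNum e : ℚ_[p]) - h.val (y j) * (f j).val x‖ ≤ (1 / 2) ^ n := by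
  obtain ⟨⟨⟨m, k, a⟩, k', b⟩, ha, hb, hmn, rfl⟩ := hd
  simp only at ha hb hmn
  have h1 := (partitionTable_realizes hs j).dist_le_of_decides hq (val_partition_mem H hx j) ha
  have h2 := (homeoTable_realizes hs).dist_le_of_decides (cauchyNaming_point hs j)
    (val_mem_of_mem H (H.isDugundjiSystem.mem j)) hb
  rw [dist_eq_norm] at h1 h2
  rw [ratNum_ratMul, Rat.cast_mul]
  refine Padic.norm_mul_sub_mul_le (H.partition.norm_le_one j x (H.mem_iUnion hx))
    (Padic.norm_ratNum_le b) h2 h1 ?_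
  have h3 : ((b.unpair.2 : ℝ) + 1) * 2 ^ n ≤ 2 ^ m := by exact_mod_cast hmn
  rw [one_div, inv_pow, inv_pow, ← div_eq_mul_inv, div_le_iff₀ (by positivity), inv_mul_eq_div,
    le_div_iff₀ (by positivity)]
  exact h3

theorem exists_approxTerm (H : ThetaDom ν A V y f h)
    (hs : thetaInputNaming p ν s (A, (V, y), f, h)) (hq : cauchyNaming ν q x) (hx : x ∉ A)
    (j n : ℕ) : ∃ e, ApproxTerm s q j n e := by
  obtain ⟨k', b, hb⟩ := (homeoTable_realizes hs).exists_decides (cauchyNaming_point hs j)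
    (val_mem_of_mem H (H.isDugundjiSystem.mem j)) n
  obtain ⟨k, a, ha⟩ := (partitionTable_realizes hs j).exists_decides hq (val_partition_mem H hx j)
    -- The precision for `f j x` depends on the approximation `b` of `h (y j)`, which is found
    -- first. This crude choice works because `N ≤ 2 ^ N`.
    ((b.unpair.2 + 1) * 2 ^ n)
  exact ⟨_, ((_, k, a), k', b), ha, hb, Nat.lt_two_pow_self.le, rfl⟩

theorem exists_farApprox (H : ThetaDom ν A V y f h)
    (hs : thetaInputNaming p ν s (A, (V, y), f, h)) (hq : cauchyNaming ν q x) (hx : x ∉ A)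
    (n : ℕ) : ∃ d, FarApprox ν s q n d := by
  have hxV := H.mem_iUnion hx
  rw [iUnion_eq hs] at hxV
  obtain ⟨b, hb⟩ := Set.mem_iUnion.1 hxV
  cases hba : ballCode s b with
  | zero => rw [hba] at hb; exact hb.elim
  | succ a =>
    rw [hba] at hb
    replace hb : dist x (ν a.unpair.1) < (posRatNum a.unpair.2 : ℝ) := hb
    -- Half of the gap: one `(1 / 2) ^ t` pays for replacing `x` by its approximation, another for
    -- the margin in the tested inequality.
    obtain ⟨t, ht⟩ := exists_pow_lt_of_lt_one (half_pos (sub_pos.2 hb))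
      (show (1 / 2 : ℝ) < 1 by norm_num)
    have h1 := hq.dist_le t
    have h2 := dist_triangle (ν (q t)) x (ν a.unpair.1)
    obtain ⟨r, hr1, hr2⟩ := exists_rat_btwn (show dist (ν (q t)) (ν a.unpair.1) <
      (posRatNum a.unpair.2 : ℝ) - (1 / 2) ^ t by linarith)
    obtain ⟨r, rfl⟩ := ratNum_surjective r
    choose e he using fun j => exists_approxTerm H hs hq hx j n
    refine ⟨_, ((List.range (indexCode s b)).map e, (b, a), t, q t, r), hba, rfl, hr1, ?_, by simp,
      fun j hj => ?_, rfl⟩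
    · rw [ratLt_iff, ratNum_ratAdd, ratNum_halfPow, ratNum_posRat, ← Rat.cast_lt (K := ℝ)]
      push_cast
      linarith
    · have hj' : j < indexCode s b := by simpa using hj
      simpa [List.getD_eq_getElem?_getD, hj'] using he j

variable [Nonempty X]

/-- The dense point gives `d(x, A) < (1 / 2) ^ (k + 1)`, so almost closest points `c` have `d(x, c)
< (1 / 2) ^ k`. For `j < k` the shifted name spends only half of `(1 / 2) ^ j` on its own error, so
`c` is compatible with the prefix that was read. -/
theorem NearApprox.norm_le (hν : DenseRange ν) (H : ThetaDom ν A V y f h)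
    (hs : thetaInputNaming p ν s (A, (V, y), f, h)) (hq : cauchyNaming ν q x)
    (hd : NearApprox ν s q n d) :
    ‖h.val (retract A y f h x) - (ratNum d : ℚ_[p])‖ ≤ (1 / 2) ^ n := by
  obtain ⟨⟨⟨k, i⟩, a, b⟩, hdec, hqa, hzb, hab⟩ := hd
  simp only [ratNum_halfPow] at hdec hqa hzb hab
  push_cast at hab
  obtain ⟨z, hz, -⟩ := exists_dense hs H.nonempty
  have hxz : dist x (z i) < (1 / 2) ^ (k + 1) := by
    have h1 := hq.dist_le (k + 4)
    have h2 := (hz i).2.1.dist_le (k + 4)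
    rw [hqa] at h1
    simp only [hzb, Nat.add_sub_cancel] at h2
    have h3 := dist_triangle4 x (ν a) (ν b) (z i)
    rw [dist_comm x (ν a)] at h3
    have h4 : (0 : ℝ) < (1 / 2) ^ k := by positivity
    rw [pow_add] at h1 h2 hab ⊢
    linarith
  refine H.norm_val_retract_sub_le (by positivity) fun c hc hxc => ?_
  rw [← dist_eq_norm, dist_comm]
  refine (homeoTable_realizes hs).dist_le_of_decides_of_lt hν hq.shift hdec (fun j hj => ?_)
    (val_mem_of_mem H hc)
  have h1 := hq.dist_le (j + 1)
  have h2 := Metric.infDist_le_dist_of_mem (x := x) (hz i).2.2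
  have h3 : (1 / 2 : ℝ) ^ k ≤ (1 / 2) ^ (j + 1) :=
    pow_le_pow_of_le_one (by norm_num) (by norm_num) hj
  rw [pow_succ] at h1 h3 hxz
  linarith [dist_triangle (ν (q (j + 1))) x c]

/-- The tested inequalities place `x` in a ball of the exhaustion, hence off `A`, and the ball
bounds the support. The error of the sum is at most the largest error of a term. -/
theorem FarApprox.norm_le (H : ThetaDom ν A V y f h)
    (hs : thetaInputNaming p ν s (A, (V, y), f, h)) (hq : cauchyNaming ν q x)
    (hd : FarApprox ν s q n d) :
    ‖h.val (retract A y f h x) - (ratNum d : ℚ_[p])‖ ≤ (1 / 2) ^ n := by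
  obtain ⟨⟨l, ⟨b, a⟩, t, c, r⟩, hba, hqc, hca, hr, hl, hterm, rfl⟩ := hd
  simp only at hba hqc hca hr hl hterm
  have hxb : x ∈ idealBall' ν (ballCode s b) := by
    rw [hba]
    rw [ratLt_iff, ratNum_ratAdd, ratNum_halfPow, ratNum_posRat, ← Rat.cast_lt (K := ℝ)] at hr
    push_cast at hr
    have h1 := hq.dist_le t
    rw [hqc] at h1
    have h2 := dist_triangle_left x (ν a.unpair.1) (ν c)
    exact Metric.mem_ball.2 (by linarith)
  have hx : x ∉ A := by
    have : x ∈ ⋃ j, V j := by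
      rw [iUnion_eq hs]
      exact Set.mem_iUnion.2 ⟨b, hxb⟩
    rwa [H.iUnion_eq] at this
  rw [H.val_retract_of_notMem hx, finsum_val_mul_val_eq_sum (s := Finset.range l.length),
    ratNum_ratSum, ← List.sum_range_getD, Rat.cast_sum, ← Finset.sum_sub_distrib]
  · refine IsUltrametricDist.norm_sum_le_of_forall_le_of_nonneg (by positivity) fun j hj => ?_
    rw [norm_sub_rev]
    exact (hterm j (Finset.mem_range.1 hj)).norm_le H hs hq hx
  · intro j hj
    rw [Finset.mem_range, ← hl]
    exact lt_indexCode hs ⟨x, H.partition.subordinate j x (H.mem_iUnion hx) hj, hxb⟩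

end ThetaInput

/-! ### Computability of the operator -/

open ThetaInput in
/-- The operator `θ` is computable on every computable metric space. -/
theorem isComputableMap_theta {X : Type*} [MetricSpace X] [Nonempty X] {ν : ℕ → X}
    (hν : IsComputableMetricSpace ν) (p : ℕ) [Fact p.Prime] :
    IsComputableMap (thetaInputNaming p ν) (funNaming (cauchyNaming ν) (padicNaming p))
      (theta (p := p) ν) := by
  -- Precision `n + 2` turns the weak bound into the strict bound `(1 / 2) ^ (n + 1)` that
  -- `cauchyNaming.of_dist_lt` asks for.
  have hR : IsSemidecidable fun (x : ℕ × ℕ) s q =>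
      NearApprox ν s q (x.1 + 2) x.2 ∨ FarApprox ν s q (x.1 + 2) x.2 := by
    have hc : Computable fun x : ℕ × ℕ => (x.1 + 2, x.2) :=
      (Computable.succ.comp (Computable.succ.comp Computable.fst)).pair Computable.snd
    have hnear : IsSemidecidable fun (x : ℕ × ℕ) s q => NearApprox ν s q (x.1 + 2) x.2 :=
      (isSemidecidable_nearApprox hν).comp (f := fun x : ℕ × ℕ => (x.1 + 2, x.2)) hc
    have hfar : IsSemidecidable fun (x : ℕ × ℕ) s q => FarApprox ν s q (x.1 + 2) x.2 :=
      (isSemidecidable_farApprox hν).comp (f := fun x : ℕ × ℕ => (x.1 + 2, x.2)) hc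
    exact hnear.or hfar
  obtain ⟨c, hc, hcR⟩ := hR.exists_realizer
  refine ⟨c, hc, ?_⟩
  rintro s ⟨A, ⟨V, y⟩, f, h⟩ _ hs ⟨H, rfl⟩
  obtain ⟨c', hc', hcR⟩ := hcR s
  refine ⟨c', hc', fun q x v hq hv => ?_⟩
  obtain rfl : v = h.val (retract A y f h x) := by simpa [theta] using hv
  -- The case distinction on `x ∈ A` only shows that the search succeeds; the search itself accepts
  -- whichever certificate it meets.
  obtain ⟨r, hr, hrR⟩ := hcR q fun n => by
    by_cases hx : x ∈ A
    · exact (exists_nearApprox H hs hq hx (n + 2)).imp fun _ => Or.inl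
    · exact (exists_farApprox H hs hq hx (n + 2)).imp fun _ => Or.inr
  refine ⟨r, hr, cauchyNaming.of_dist_lt fun n => ?_⟩
  rw [dist_comm, dist_eq_norm]
  refine lt_of_le_of_lt ?_ (pow_lt_pow_right_of_lt_one₀ (show (0 : ℝ) < 1 / 2 by norm_num)
    (by norm_num) (Nat.lt_succ_self (n + 1)))
  exact (hrR n).elim (NearApprox.norm_le hν.dense H hs hq) (FarApprox.norm_le H hs hq)

theorem mainTheorem4 {X : Type*} [MetricSpace X] [Nonempty X] (ν : ℕ → X)
    (hν : IsComputableMetricSpace ν) (hdim : IsZeroDimensional X)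
    (p : ℕ) [Fact p.Prime]
    (hβ_compact : ∀ (x : X) (N : ℕ), IsCompact (Metric.closedBall x ((1 / 2 : ℝ) ^ N)))
    (hβ : IsComputableMap (prodNaming (cauchyNaming ν) natNaming) (compactNaming ν)
      (PFun.lift fun z : X × ℕ => Metric.closedBall z.1 ((1 / 2 : ℝ) ^ z.2))) :
    -- the operator is well defined, with values in the continuous maps
    (∀ (A : Set X) (V : ℕ → Set X) (y : ℕ → X) (f : ℕ → X →. ℚ_[p]) (h : X →. ℚ_[p]),
      ThetaDom ν A V y f h →
        (∀ x ∉ A, (Function.support fun i => h.val (y i) * (f i).val x).Finite ∧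
          ∑ᶠ i, h.val (y i) * (f i).val x ∈ h.val '' A) ∧
        Continuous (retract A y f h) ∧
        Continuous (fun x => h.val (retract A y f h x))) ∧
    -- and it is computable
    IsComputableMap (thetaInputNaming p ν)
      (funNaming (cauchyNaming ν) (padicNaming p)) (theta (p := p) ν) := by

  refine ⟨fun A V y f h H => ⟨fun x hx => ⟨?_, H.finsum_mem hx⟩, H.continuous_retract hν.dense,
    H.continuous_val_retract hν.dense⟩, isComputableMap_theta hν p⟩
  exact (H.support_finite hx).subset fun i hi => right_ne_zero_of_mul hi
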